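/- Let $l,k\ge 1$ be integers. For $n\ge 0$ and $\Re s>1$ let $$\zeta(\{1\}^n,s)=\sum_{0<m_1<\dots<m_{n+1}}\frac{1}{m_1\cdots m_n\,m_{n+1}^{s}}$$ (so $\zeta(\{1\}^0,s)=\zeta(s)$). For $j\ge1$, $i\ge 1$ let $$\zeta_{MT}(\{2\}^j;i)=\sum_{m_1,\dots,m_j\ge1}\frac{1}{m_1^2\cdots m_j^2(m_1+\dots+m_j)^i},$$ and for $\Re s>1-j$ let $$\xi_{MT}((\{2\}^j;k);s)=\frac1{\Gamma(s)}\int_0^\infty \frac{t^{s-1}}{e^t-1}\,\mathrm{Li}_{\{2\}^j;k}(1-e^{-t})\,dt,\qquad \mathrm{Li}_{\{2\}^j;k}(z)=\sum_{m_1,\dots,m_j\ge1}\frac{z^{m_1+\dots+m_j}}{m_1^2\cdots m_j^2(m_1+\dots+m_j)^k}\quad(|z|<1).$$ For integers $a,b_1,\dots,b_{k+1}\ge0$ with $a+b_1+\dots+b_{k+1}=l$ and $\Re s>1$ let $\zeta_{MT}(0,\{2\}^a,\{1\}^{l-a};b_1+1,\dots,b_k+1,b_{k+1}+s)$ denote the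 Miyagawa-type series $$\sum_{m_0,\dots,m_l\ge1}\ \sum_{p_1,\dots,p_k\ge1}\frac{1}{m_1^2\cdots m_a^2\,m_{a+1}\cdots m_l\;\prod_{u=1}^{k}\bigl(N+p_1+\dots+p_{u-1}\bigr)^{b_u+1}\,\bigl(N+p_1+\dots+p_k\bigr)^{b_{k+1}+s}},\qquad N=m_0+\dots+m_l.$$ All these series and integrals converge absolutely in the stated ranges, and those depending on $s$ define holomorphic functions there which continue meromorphically to all $s\in\mathbb C$. With the same notation for the continuations, one has, as an identity of meromorphic functions on $\mathbb C$ (that is, at every $s\in\mathbb C$ that is not a pole of one of the functions involved), $$\zeta(2)^l\zeta(\{1\}^k,s)+\sum_{j=1}^l\binom lj\zeta(2)^{l-j}(-1)^j\Bigl(\sum_{i=1}^k(-1)^{i-1}\zeta_{MT}(\{2\}^j;i)\,\zeta(\{1\}^{k-i},s)+(-1)^k\xi_{MT}((\{2\}^j;k);s)\Bigr)$$ $$=\sum_{a+b_1+\dots+b_{k+1}=l}\frac{l!}{a!}\binom{s+b_{k+1}-1}{b_{k+1}}\,\zeta_{MT}(0,\{2\}^a,\{1\}^{l-a};b_1+1,\dots,b_k+1,b_{k+1}+s),$$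 where the last sum is over all integers $a,b_1,\dots,b_{k+1}\ge0$ with $a+b_1+\dots+b_{k+1}=l$, and $\binom{s+b-1}{b}=s(s+1)\cdots(s+b-1)/b!$. -/

import Mathlib

open Set Filter Topology MeasureTheory Finset
open scoped Nat

noncomputable section

/-- The term `1 / (m₁^{s₁} ⋯ mₙ^{sₙ})` of the Euler–Zagier series, for `0 < m₁ < ⋯ < mₙ`. -/
def ezTerm {n : ℕ} (s : Fin n → ℂ) (m : {m : Fin n → ℕ+ // StrictMono m}) : ℂ :=
  ∏ i, 1 / (((m.1 i : ℕ) : ℂ) ^ s i)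

/-- The Euler–Zagier multiple zeta series `ζ(s₁, …, sₙ)`. -/
def ezZeta {n : ℕ} (s : Fin n → ℂ) : ℂ :=
  ∑' m : {m : Fin n → ℕ+ // StrictMono m}, ezTerm s m

/-- The index `({1}^n, s)`. -/
def onesThen (n : ℕ) (s : ℂ) : Fin (n + 1) → ℂ :=
  Fin.snoc (fun _ : Fin n => (1 : ℂ)) s

/-- The term `1 / (m₁^{s₁} ⋯ m_r^{s_r} (m₁ + ⋯ + m_r)^t)` of the Mordell–Tornheim series. -/
def mtTerm {r : ℕ} (s : Fin r → ℂ) (t : ℂ) (m : Fin r → ℕ+) : ℂ :=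
  1 / ((∏ v, ((m v : ℕ) : ℂ) ^ s v) * (∑ v, ((m v : ℕ) : ℂ)) ^ t)

/-- The Mordell–Tornheim multiple zeta series `ζ_MT(s₁, …, s_r; t)`. -/
def mtZeta {r : ℕ} (s : Fin r → ℂ) (t : ℂ) : ℂ :=
  ∑' m : Fin r → ℕ+, mtTerm s t m

/-- The term of the Miyagawa series `ζ_MT(s₁, …, s_r; t₀, …, tₙ)` at
`m₁, …, m_r, p₀, …, pₙ₋₁`:
`1 / (∏ᵥ mᵥ^{sᵥ} · ∏_{u=0}^{n} (∑ᵥ mᵥ + ∑_{w<u} p_w)^{t_u})`. -/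
def miyagawaTerm {r n : ℕ} (s : Fin r → ℂ) (t : Fin (n + 1) → ℂ)
    (x : (Fin r → ℕ+) × (Fin n → ℕ+)) : ℂ :=
  1 / ((∏ v, ((x.1 v : ℕ) : ℂ) ^ s v) *
    ∏ u : Fin (n + 1),
      (∑ v, ((x.1 v : ℕ) : ℂ) +
        ∑ w ∈ Finset.univ.filter (fun w : Fin n => w.castSucc < u), ((x.2 w : ℕ) : ℂ)) ^ t u)

/-- The Miyagawa multiple zeta series `ζ_MT(s₁, …, s_r; t₀, …, tₙ)`. -/
def miyagawaZeta {r n : ℕ} (s : Fin r → ℂ) (t : Fin (n + 1) → ℂ) : ℂ :=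
  ∑' x : (Fin r → ℕ+) × (Fin n → ℕ+), miyagawaTerm s t x

/-- The index `(0, {2}^a, {1}^{l-a})`, for `a ≤ l`. -/
def zeroTwosOnes (l a : ℕ) : Fin (l + 1) → ℂ :=
  Fin.cons 0 (fun v : Fin l => if (v : ℕ) < a then (2 : ℂ) else 1)

/-- The index `(b₁ + 1, …, b_k + 1, b_{k+1} + s)`. -/
def shiftedIndex {k : ℕ} (b : Fin (k + 1) → ℕ) (s : ℂ) : Fin (k + 1) → ℂ :=
  Fin.snoc (fun i : Fin k => (b i.castSucc : ℂ) + 1) ((b (Fin.last k) : ℂ) + s)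

/-- The polylogarithm `Li_{k₁,…,kₙ; q}(z)`, for `|z| < 1`. -/
def mtLi {n : ℕ} (k : Fin n → ℕ) (q : ℕ) (z : ℂ) : ℂ :=
  ∑' m : Fin n → ℕ+,
    z ^ (∑ i, (m i : ℕ)) / ((∏ i, ((m i : ℕ) : ℂ) ^ k i) * (∑ i, ((m i : ℕ) : ℂ)) ^ q)

/-- The integrand `t^{s-1} / (e^t - 1) · Li_{k₁,…,kₙ; q}(1 - e^{-t})`. -/
def itoIntegrand {n : ℕ} (k : Fin n → ℕ) (q : ℕ) (s : ℂ) (t : ℝ) : ℂ :=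
  (t : ℂ) ^ (s - 1) / (Complex.exp t - 1) * mtLi k q (1 - Complex.exp (-t))

/-- The generalized Ito zeta function `ξ_MT((k₁,…,kₙ; q); s)`, for `Re s > 1 - n`. -/
def itoXi {n : ℕ} (k : Fin n → ℕ) (q : ℕ) (s : ℂ) : ℂ :=
  1 / Complex.Gamma s * ∫ t in Ioi (0 : ℝ), itoIntegrand k q s t

/-- `F` is the meromorphic continuation to `ℂ` of the function `f`, holomorphic on the half-plane
`Re s > σ`. `F` is taken in normal form (removable singularities are removed, and the value at a
pole is `0`), so it is unique, and the points where it fails to be analytic are its poles. -/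
def IsMeromorphicContinuation (σ : ℝ) (f F : ℂ → ℂ) : Prop :=
  DifferentiableOn ℂ f {s | σ < s.re} ∧
    EqOn F f {s | σ < s.re} ∧ MeromorphicNFOn F univ

/-- The binomial coefficient `binom(s + b - 1, b) = s (s + 1) ⋯ (s + b - 1) / b!`. -/
def risingChoose (s : ℂ) (b : ℕ) : ℂ :=
  (∏ i ∈ Finset.range b, (s + i)) / (b ! : ℂ)

end

/-! Let T h(t) = ∫_t^∞ h(u)/(e^u - 1) du (`boseInt`). For Re s > 1 both sides of the identity equal
1/Γ(s) times the Mellin transform of (e^t - 1)⁻¹ T^k[(T id)^l](t), where id(t) = t; they come from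
two ways of writing T id.

Left side: with r = 1 - e^{-t} one has dr/r = dt/(e^t - 1) and t = Li₁(r), so T id = ζ(2) - Li₂(r),
and T sends Li_{{2}^j;i}(r) to ζ_MT({2}^j; i+1) - Li_{{2}^j;i+1}(r). The binomial theorem and k
applications of T leave the values ζ_MT, the functions T^{k-i} 1 (whose Mellin transforms give
ζ({1}^{k-i}, s)) and Li_{{2}^j;k}(r) (which gives ξ_MT). This is `mellin_boseInt_pow_eq_itoXi`.

Right side: one integration by parts gives T id = Li₂(e^{-t}) + t Li₁(e^{-t}). After the binomial
expansion, repeated integration by parts moves powers of t out through T^k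
(`iterate_boseInt_pow_mul`): each unit of degree either becomes one more tail integral, raising some
b_u, or stays outside as a power of t, which shifts the Mellin variable to s + b_{k+1}. What remains
is a series of exponentials, whose Mellin transform is the Miyagawa series. This is
`mellin_boseInt_pow_eq_miyagawaZeta`.

Continuation: every function involved is continuous on (0, ∞), grows subexponentially, and expands
at 0 in monomials t^i (log t)^j. This class is stable under T, and such expansions make Mellin
transforms meromorphic on ℂ. The identity theorem then carries the half-plane identity to all s.
Absolute convergence of the series in s follows from convergence of Mellin integrals, by positivity
of coefficients. -/

noncomputable section

/-! ### Expansions at `0` in powers of `t` and `log t` -/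

/-- The monomial `t ^ i * (log t) ^ j`. -/
def logMonomial (i j : ℕ) (t : ℝ) : ℂ :=
  (t : ℂ) ^ i * (Real.log t : ℂ) ^ j

/-- The span of the monomials `t ^ i * (log t) ^ j`. -/
def logSpan : Submodule ℂ (ℝ → ℂ) :=
  Submodule.span ℂ (Set.range fun p : ℕ × ℕ => logMonomial p.1 p.2)

/-- `h` has an asymptotic expansion to all orders at `0⁺` in the monomials
`t ^ i * (log t) ^ j`. -/
def HasLogExpansion (h : ℝ → ℂ) : Prop :=
  ∀ R : ℕ, ∃ P ∈ logSpan, (fun t => h t - P t) =O[𝓝[>] 0] fun t : ℝ => t ^ R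

theorem logMonomial_mem (i j : ℕ) : logMonomial i j ∈ logSpan :=
  Submodule.subset_span ⟨(i, j), rfl⟩

theorem logSpan_induction {p : (P : ℝ → ℂ) → P ∈ logSpan → Prop}
    (mono : ∀ i j, p (logMonomial i j) (logMonomial_mem i j)) (zero : p 0 logSpan.zero_mem)
    (add : ∀ f g hf hg, p f hf → p g hg → p (f + g) (logSpan.add_mem hf hg))
    (smul : ∀ (c : ℂ) f hf, p f hf → p (c • f) (logSpan.smul_mem c hf))
    {P : ℝ → ℂ} (hP : P ∈ logSpan) : p P hP := by
  refine Submodule.span_induction (p := p) ?_ zero add smul hP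
  rintro _ ⟨q, rfl⟩
  exact mono _ _

theorem logSpan_mul {P Q : ℝ → ℂ} (hP : P ∈ logSpan) (hQ : Q ∈ logSpan) : P * Q ∈ logSpan := by
  have h := Submodule.mul_mem_mul hP hQ
  rw [logSpan, Submodule.span_mul_span] at h
  refine Submodule.span_mono ?_ h
  rintro _ ⟨_, ⟨p, rfl⟩, _, ⟨q, rfl⟩, rfl⟩
  refine ⟨(p.1 + q.1, p.2 + q.2), ?_⟩
  funext t
  simp only [logMonomial, Pi.mul_apply]
  ring

theorem logSpan_const (c : ℂ) : (fun _ => c) ∈ logSpan := by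
  have h := logSpan.smul_mem c (logMonomial_mem 0 0)
  convert h using 1
  funext t
  simp [logMonomial]

theorem logSpan_continuousOn {P : ℝ → ℂ} (hP : P ∈ logSpan) : ContinuousOn P (Ioi 0) := by
  induction hP using logSpan_induction with
  | mono i j =>
    unfold logMonomial
    refine ContinuousOn.mul (by fun_prop) (ContinuousOn.pow ?_ _)
    exact Complex.continuous_ofReal.comp_continuousOn
      (Real.continuousOn_log.mono fun t ht => (ne_of_gt ht : t ≠ 0))
  | zero => exact continuousOn_const
  | add f g _ _ hf hg => exact hf.add hg
  | smul c f _ hf => exact hf.const_smul c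

theorem logSpan_isBigO {P : ℝ → ℂ} (hP : P ∈ logSpan) {ε : ℝ} (hε : 0 < ε) :
    P =O[𝓝[>] 0] fun t : ℝ => t ^ (-ε) := by
  induction hP using logSpan_induction with
  | mono i j =>
    unfold logMonomial
    have h1 : (fun t : ℝ => (t : ℂ) ^ i) =O[𝓝[>] 0] fun _ : ℝ => (1 : ℝ) := by
      have : Continuous fun t : ℝ => (t : ℂ) ^ i := by fun_prop
      exact ((this.tendsto 0).mono_left nhdsWithin_le_nhds).isBigO_one ℝ
    have h2 : (fun t : ℝ => (Real.log t : ℂ) ^ j) =O[𝓝[>] 0] fun t : ℝ => t ^ (-ε) := by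
      have := (isLittleO_abs_log_rpow_rpow_nhdsGT_zero (s := -ε) (j : ℝ) (by linarith)).isBigO
      refine (Asymptotics.IsBigO.of_norm_left ?_)
      refine this.congr_left fun t => ?_
      simp
    simpa using h1.mul h2
  | zero => exact Asymptotics.isBigO_zero _ _
  | add f g _ _ hf hg => exact hf.add hg
  | smul c f _ hf => exact hf.const_smul_left c

/-- Integration against dt/t preserves the span. For i = 0 it raises the power of log t, which is
why logarithms must be allowed; for i > 0, integration by parts lowers j. -/
theorem logMonomial_hasDerivAt_antideriv (i j : ℕ) :
    ∃ Q ∈ logSpan, ∀ t : ℝ, 0 < t → HasDerivAt Q ((t : ℂ)⁻¹ * logMonomial i j t) t := by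
  have hlog : ∀ (j : ℕ) (t : ℝ), 0 < t → HasDerivAt (fun t : ℝ => (Real.log t : ℂ) ^ (j + 1))
      (((j : ℂ) + 1) * (Real.log t : ℂ) ^ j * (t : ℂ)⁻¹) t := by
    intro j t ht
    exact (((Real.hasDerivAt_log ht.ne').ofReal_comp).fun_pow (j + 1)).congr_deriv (by simp)
  rcases Nat.eq_zero_or_pos i with rfl | hi
  · refine ⟨((j : ℂ) + 1)⁻¹ • logMonomial 0 (j + 1), logSpan.smul_mem _ (logMonomial_mem _ _), ?_⟩
    intro t ht
    have h := (hlog j t ht).const_mul (((j : ℂ) + 1)⁻¹)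
    have hj : (j : ℂ) + 1 ≠ 0 := by exact_mod_cast Nat.succ_ne_zero j
    refine (h.congr_of_eventuallyEq ?_).congr_deriv ?_
    · exact Eventually.of_forall fun u => by simp [logMonomial]
    · simp only [logMonomial]; field_simp
  · obtain ⟨i, rfl⟩ := Nat.exists_eq_add_of_lt hi
    rw [zero_add]
    have hi0 : (i : ℂ) + 1 ≠ 0 := by exact_mod_cast Nat.succ_ne_zero i
    have hpow : ∀ t : ℝ, HasDerivAt (fun t : ℝ => (t : ℂ) ^ (i + 1))
        (((i : ℂ) + 1) * (t : ℂ) ^ i) t := by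
      intro t
      exact (((hasDerivAt_id t).ofReal_comp).fun_pow (i + 1)).congr_deriv (by simp)
    induction j with
    | zero =>
      refine ⟨((i : ℂ) + 1)⁻¹ • logMonomial (i + 1) 0, logSpan.smul_mem _ (logMonomial_mem _ _), ?_⟩
      intro t ht
      have h := (hpow t).const_mul (((i : ℂ) + 1)⁻¹)
      have ht0 : (t : ℂ) ≠ 0 := by exact_mod_cast ht.ne'
      refine (h.congr_of_eventuallyEq ?_).congr_deriv ?_
      · exact Eventually.of_forall fun u => by simp [logMonomial]
      · simp only [logMonomial]; field_simp; ring
    | succ j ih =>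
      obtain ⟨Q, hQ, hd⟩ := ih
      refine ⟨((i : ℂ) + 1)⁻¹ • (logMonomial (i + 1) (j + 1) - ((j : ℂ) + 1) • Q),
        logSpan.smul_mem _ (logSpan.sub_mem (logMonomial_mem _ _) (logSpan.smul_mem _ hQ)), ?_⟩
      intro t ht
      have h := ((((hpow t).mul (hlog j t ht)).sub
        ((hd t ht).const_mul ((j : ℂ) + 1))).const_mul (((i : ℂ) + 1)⁻¹))
      have ht0 : (t : ℂ) ≠ 0 := by exact_mod_cast ht.ne'
      refine HasDerivAt.congr_deriv (f' := _) (h.congr_of_eventuallyEq ?_) ?_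
      · exact Eventually.of_forall fun u => by simp [logMonomial]
      · simp only [logMonomial]; field_simp; ring

theorem logSpan_hasDerivAt_antideriv {P : ℝ → ℂ} (hP : P ∈ logSpan) :
    ∃ Q ∈ logSpan, ∀ t : ℝ, 0 < t → HasDerivAt Q ((t : ℂ)⁻¹ * P t) t := by
  induction hP using logSpan_induction with
  | mono i j => exact logMonomial_hasDerivAt_antideriv i j
  | zero => exact ⟨0, logSpan.zero_mem, fun t _ => by exact (hasDerivAt_const t (0 : ℂ)).congr_deriv (by simp)⟩
  | add f g _ _ hf hg =>
    obtain ⟨Q, hQ, hd⟩ := hf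
    obtain ⟨Q', hQ', hd'⟩ := hg
    exact ⟨Q + Q', logSpan.add_mem hQ hQ', fun t ht => by
      simpa [mul_add] using (hd t ht).add (hd' t ht)⟩
  | smul c f _ hf =>
    obtain ⟨Q, hQ, hd⟩ := hf
    refine ⟨c • Q, logSpan.smul_mem c hQ, fun t ht => ?_⟩
    have := (hd t ht).const_mul c
    refine this.congr_deriv ?_
    simp only [Pi.smul_apply, smul_eq_mul]
    ring

/-! ### Closure properties of logarithmic expansions. -/

namespace HasLogExpansion

variable {g h : ℝ → ℂ}

theorem of_mem {P : ℝ → ℂ} (hP : P ∈ logSpan) : HasLogExpansion P := fun R =>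
  ⟨P, hP, by simpa using Asymptotics.isBigO_zero _ _⟩

theorem congr (hg : HasLogExpansion g) (hgh : EqOn g h (Ioi 0)) : HasLogExpansion h := by
  intro R
  obtain ⟨P, hP, hO⟩ := hg R
  refine ⟨P, hP, hO.congr' ?_ EventuallyEq.rfl⟩
  filter_upwards [self_mem_nhdsWithin] with t ht
  rw [hgh ht]

theorem add (hg : HasLogExpansion g) (hh : HasLogExpansion h) :
    HasLogExpansion fun t => g t + h t := by
  intro R
  obtain ⟨P, hP, hO⟩ := hg R
  obtain ⟨Q, hQ, hO'⟩ := hh R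
  refine ⟨P + Q, logSpan.add_mem hP hQ, (hO.add hO').congr_left fun t => ?_⟩
  simp only [Pi.add_apply]
  ring

theorem isBigO (hh : HasLogExpansion h) {ε : ℝ} (hε : 0 < ε) :
    h =O[𝓝[>] 0] fun t : ℝ => t ^ (-ε) := by
  obtain ⟨P, hP, hO⟩ := hh 0
  have h1 : (fun _ : ℝ => (1 : ℝ)) =O[𝓝[>] 0] fun t : ℝ => t ^ (-ε) := by
    refine Asymptotics.IsBigO.of_bound 1 ?_
    filter_upwards [Ioo_mem_nhdsGT (zero_lt_one (α := ℝ))] with t ht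
    rw [norm_one, one_mul, Real.norm_of_nonneg (Real.rpow_nonneg ht.1.le _)]
    exact Real.one_le_rpow_of_pos_of_le_one_of_nonpos ht.1 ht.2.le (by linarith)
  have := ((by simpa using hO : (fun t => h t - P t) =O[𝓝[>] 0] fun _ : ℝ => (1 : ℝ)).trans
    h1).add (logSpan_isBigO hP hε)
  simpa using this

theorem mul (hg : HasLogExpansion g) (hh : HasLogExpansion h) :
    HasLogExpansion fun t => g t * h t := by
  intro R
  -- One extra order pays for the other factor, which may blow up logarithmically and is bounded
  -- crudely by t⁻¹.
  obtain ⟨P, hP, hO⟩ := hg (R + 1)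
  obtain ⟨Q, hQ, hO'⟩ := hh (R + 1)
  have key : (fun t : ℝ => t ^ (R + 1) * t ^ (-(1 : ℝ))) =ᶠ[𝓝[>] 0] fun t : ℝ => t ^ R := by
    filter_upwards [self_mem_nhdsWithin] with t ht
    have : t ≠ 0 := ne_of_gt ht
    rw [Real.rpow_neg_one, pow_succ, mul_assoc, mul_inv_cancel₀ this, mul_one]
  refine ⟨P * Q, logSpan_mul hP hQ, ?_⟩
  have h1 := (hO.mul (hh.isBigO one_pos)).trans_eventuallyEq key
  have h2 := (hO'.mul (logSpan_isBigO hP one_pos)).trans_eventuallyEq key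
  refine (h1.add h2).congr_left fun t => ?_
  simp only [Pi.mul_apply]
  ring

theorem const (c : ℂ) : HasLogExpansion fun _ => c := of_mem (logSpan_const c)

theorem of_analyticAt {f : ℝ → ℂ} (hf : AnalyticAt ℝ f 0) : HasLogExpansion f := by
  intro R
  obtain ⟨p, hp⟩ := hf
  have h := hp.isBigO_sub_partialSum_pow R
  refine ⟨fun t => p.partialSum R t, ?_, ?_⟩
  · have : (fun t : ℝ => p.partialSum R t) =
        ∑ k ∈ Finset.range R, p.coeff k • logMonomial k 0 := by
      funext t
      simp only [FormalMultilinearSeries.partialSum, Finset.sum_apply, Pi.smul_apply, smul_eq_mul,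
        logMonomial, pow_zero, mul_one]
      refine Finset.sum_congr rfl fun k _ => ?_
      rw [FormalMultilinearSeries.apply_eq_pow_smul_coeff, mul_comm, Complex.real_smul,
        Complex.ofReal_pow]
    rw [this]
    exact logSpan.sum_mem fun k _ => logSpan.smul_mem _ (logMonomial_mem _ _)
  · have h' := (h.mono (nhdsWithin_le_nhds (s := Ioi (0 : ℝ))))
    refine (h'.congr_left fun t => by rw [zero_add]).trans_eventuallyEq ?_
    filter_upwards [self_mem_nhdsWithin] with t ht
    rw [Real.norm_of_nonneg (le_of_lt ht)]

end HasLogExpansion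

/-! ### Functions of moderate growth and of exponential decay -/

/-- Continuous functions on `(0, ∞)` with a logarithmic expansion at `0` and subexponential growth
at infinity. -/
structure Tame (h : ℝ → ℂ) : Prop where
  continuousOn : ContinuousOn h (Ioi 0)
  expansion : HasLogExpansion h
  growth : ∀ c : ℝ, 0 < c → h =O[atTop] fun t : ℝ => Real.exp (c * t)

/-- Continuous functions on `(0, ∞)` with a logarithmic expansion at `0` and exponential decay
at infinity. -/
structure Rapid (h : ℝ → ℂ) : Prop where
  continuousOn : ContinuousOn h (Ioi 0)
  expansion : HasLogExpansion h
  decay : ∃ c : ℝ, 0 < c ∧ h =O[atTop] fun t : ℝ => Real.exp (-c * t)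

theorem isBigO_exp_mul_of_le {a b : ℝ} (h : a ≤ b) :
    (fun t : ℝ => Real.exp (a * t)) =O[atTop] fun t : ℝ => Real.exp (b * t) := by
  refine Asymptotics.IsBigO.of_bound 1 ?_
  filter_upwards [eventually_ge_atTop (0 : ℝ)] with t ht
  rw [Real.norm_of_nonneg (Real.exp_pos _).le, Real.norm_of_nonneg (Real.exp_pos _).le, one_mul]
  exact Real.exp_le_exp.2 (mul_le_mul_of_nonneg_right h ht)

theorem Rapid.tame {h : ℝ → ℂ} (hh : Rapid h) : Tame h where
  continuousOn := hh.continuousOn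
  expansion := hh.expansion
  growth c hc := by
    obtain ⟨d, hd, hO⟩ := hh.decay
    exact hO.trans (isBigO_exp_mul_of_le (by linarith))

namespace Tame

variable {g h : ℝ → ℂ}

theorem congr (hg : Tame g) (hgh : EqOn g h (Ioi 0)) : Tame h where
  continuousOn := hg.continuousOn.congr hgh.symm
  expansion := hg.expansion.congr hgh
  growth c hc := (hg.growth c hc).congr'
    (by filter_upwards [eventually_gt_atTop (0 : ℝ)] with t ht using hgh ht) EventuallyEq.rfl

theorem add (hg : Tame g) (hh : Tame h) : Tame fun t => g t + h t where
  continuousOn := hg.continuousOn.add hh.continuousOn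
  expansion := hg.expansion.add hh.expansion
  growth c hc := (hg.growth c hc).add (hh.growth c hc)

theorem mul (hg : Tame g) (hh : Tame h) : Tame fun t => g t * h t where
  continuousOn := hg.continuousOn.mul hh.continuousOn
  expansion := hg.expansion.mul hh.expansion
  growth c hc := by
    refine ((hg.growth (c / 2) (half_pos hc)).mul (hh.growth (c / 2) (half_pos hc))).congr_right
      fun t => ?_
    rw [← Real.exp_add]
    ring_nf

theorem mul_rapid (hg : Tame g) (hh : Rapid h) : Rapid fun t => g t * h t where
  continuousOn := hg.continuousOn.mul hh.continuousOn
  expansion := hg.expansion.mul hh.expansion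
  decay := by
    obtain ⟨c, hc, hO⟩ := hh.decay
    refine ⟨c / 2, half_pos hc, ((hg.growth (c / 2) (half_pos hc)).mul hO).congr_right
      fun t => ?_⟩
    rw [← Real.exp_add]
    ring_nf

theorem const (c : ℂ) : Tame fun _ => c where
  continuousOn := continuousOn_const
  expansion := .const c
  growth d hd := by
    refine (Asymptotics.isBigO_const_const c (one_ne_zero (α := ℝ)) _).trans ?_
    simpa using isBigO_exp_mul_of_le hd.le

theorem ofReal_pow (n : ℕ) : Tame fun t => (t : ℂ) ^ n where
  continuousOn := by fun_prop
  expansion := (HasLogExpansion.of_mem (logMonomial_mem n 0)).congr fun t _ => by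
    simp [logMonomial]
  growth c hc := by
    refine Asymptotics.IsBigO.of_norm_left ?_
    simpa using (isLittleO_pow_exp_pos_mul_atTop n hc).isBigO.norm_left

theorem ofReal : Tame fun t => (t : ℂ) := by
  simpa using Tame.ofReal_pow 1

theorem pow (hh : Tame h) (n : ℕ) : Tame fun t => h t ^ n := by
  induction n with
  | zero => simpa using Tame.const 1
  | succ n ih => simpa only [pow_succ] using ih.mul hh

theorem sum {ι : Type*} (s : Finset ι) {f : ι → ℝ → ℂ} (hf : ∀ i ∈ s, Tame (f i)) :
    Tame fun t => ∑ i ∈ s, f i t := by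
  classical
  induction s using Finset.induction_on with
  | empty => simpa using Tame.const 0
  | insert a s ha ih =>
    simp only [Finset.sum_insert ha]
    exact (hf a (Finset.mem_insert_self a s)).add
      (ih fun i hi => hf i (Finset.mem_insert_of_mem hi))

end Tame

namespace Rapid

variable {g h : ℝ → ℂ}

theorem congr (hg : Rapid g) (hgh : EqOn g h (Ioi 0)) : Rapid h where
  continuousOn := hg.continuousOn.congr hgh.symm
  expansion := hg.expansion.congr hgh
  decay := by
    obtain ⟨c, hc, hO⟩ := hg.decay
    exact ⟨c, hc, hO.congr'
      (by filter_upwards [eventually_gt_atTop (0 : ℝ)] with t ht using hgh ht) EventuallyEq.rfl⟩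

end Rapid

/-! ### Tail integrals -/

/-- The tail integral `t ↦ ∫_t^∞ h(u) du`. -/
def tailInt (h : ℝ → ℂ) (t : ℝ) : ℂ :=
  ∫ u in Ioi t, h u

theorem tailInt_congr {g h : ℝ → ℂ} (hgh : EqOn g h (Ioi 0)) :
    EqOn (tailInt g) (tailInt h) (Ioi 0) := fun _ ht =>
  setIntegral_congr_fun measurableSet_Ioi fun _ hu =>
    hgh (Set.mem_Ioi.2 (lt_trans (Set.mem_Ioi.1 ht) (Set.mem_Ioi.1 hu)))

theorem integrableOn_Ioi_of_isBigO_exp {f : ℝ → ℂ} (hf : ContinuousOn f (Ioi 0)) {c : ℝ}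
    (hc : 0 < c) (hO : f =O[atTop] fun t : ℝ => Real.exp (-c * t)) {t : ℝ} (ht : 0 < t) :
    IntegrableOn f (Ioi t) := by
  have hm : AEStronglyMeasurable f (volume.restrict (Ioi t)) :=
    (hf.mono (Ioi_subset_Ioi ht.le)).aestronglyMeasurable measurableSet_Ioi
  refine (integrable_norm_iff hm).1 ?_
  exact integrable_of_isBigO_exp_neg hc
    (hf.norm.mono fun u hu => lt_of_lt_of_le ht hu) hO.norm_left

theorem tailInt_hasDerivAt {f : ℝ → ℂ} (hf : ContinuousOn f (Ioi 0))
    (hi : ∀ t : ℝ, 0 < t → IntegrableOn f (Ioi t)) {t : ℝ} (ht : 0 < t) :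
    HasDerivAt (tailInt f) (-f t) t := by
  -- The base point is t/2 since `f` need not be integrable near 0.
  have ht2 : 0 < t / 2 := half_pos ht
  have hint : ∀ u : ℝ, t / 2 < u → IntervalIntegrable f volume (t / 2) u := fun u hu =>
    (intervalIntegrable_iff_integrableOn_Ioc_of_le hu.le).2
      ((hi _ ht2).mono_set fun x hx => hx.1)
  have hd : HasDerivAt (fun u => ∫ x in (t / 2)..u, f x) (f t) t :=
    intervalIntegral.integral_hasDerivAt_right (hint t (by linarith))
      (hf.stronglyMeasurableAtFilter isOpen_Ioi t ht) (hf.continuousAt (Ioi_mem_nhds ht))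
  have hd' := hd.const_sub (tailInt f (t / 2))
  refine hd'.congr_of_eventuallyEq ?_
  filter_upwards [Ioi_mem_nhds (show t / 2 < t by linarith)] with u hu
  have h := intervalIntegral.integral_interval_add_Ioi (hi _ ht2) (hi u (lt_trans ht2 hu))
  simp only [tailInt]
  rw [← h]
  ring

theorem tailInt_isBigO_exp {f : ℝ → ℂ} {c : ℝ} (hc : 0 < c)
    (hO : f =O[atTop] fun t : ℝ => Real.exp (-c * t)) :
    tailInt f =O[atTop] fun t : ℝ => Real.exp (-c * t) := by
  obtain ⟨K, hK⟩ := hO.bound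
  obtain ⟨A, hA⟩ := eventually_atTop.1 hK
  refine Asymptotics.IsBigO.of_bound (K / c) ?_
  filter_upwards [eventually_ge_atTop A] with t ht
  have hneg : -c < 0 := by linarith
  have h1 : ‖tailInt f t‖ ≤ ∫ u in Ioi t, K * Real.exp (-c * u) := by
    refine norm_integral_le_of_norm_le ((integrableOn_exp_mul_Ioi hneg t).const_mul K) ?_
    filter_upwards [ae_restrict_mem measurableSet_Ioi] with u hu
    simpa using hA u (ht.trans (le_of_lt hu))
  refine h1.trans (le_of_eq ?_)
  rw [integral_const_mul, integral_exp_mul_Ioi hneg, Real.norm_of_nonneg (Real.exp_pos _).le]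
  field_simp

theorem continuousOn_ofReal_inv : ContinuousOn (fun t : ℝ => (t : ℂ)⁻¹) (Ioi 0) :=
  ContinuousOn.inv₀ (by fun_prop) fun t ht => by exact_mod_cast (ne_of_gt ht : t ≠ 0)

namespace Rapid

variable {g h : ℝ → ℂ}

theorem inv_mul_decay (hg : Rapid g) : ∃ c : ℝ, 0 < c ∧
    (fun t : ℝ => (t : ℂ)⁻¹ * g t) =O[atTop] fun t : ℝ => Real.exp (-c * t) := by
  obtain ⟨c, hc, hO⟩ := hg.decay
  refine ⟨c, hc, ?_⟩
  have h1 : (fun t : ℝ => (t : ℂ)⁻¹) =O[atTop] fun _ : ℝ => (1 : ℝ) := by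
    refine Asymptotics.IsBigO.of_bound 1 ?_
    filter_upwards [eventually_ge_atTop (1 : ℝ)] with t ht
    rw [norm_inv, Complex.norm_real, Real.norm_of_nonneg (by linarith), norm_one, mul_one]
    exact inv_le_one_of_one_le₀ ht
  simpa using h1.mul hO

theorem continuousOn_inv_mul (hg : Rapid g) :
    ContinuousOn (fun t : ℝ => (t : ℂ)⁻¹ * g t) (Ioi 0) :=
  continuousOn_ofReal_inv.mul hg.continuousOn

theorem integrableOn_inv_mul (hg : Rapid g) {t : ℝ} (ht : 0 < t) :
    IntegrableOn (fun t : ℝ => (t : ℂ)⁻¹ * g t) (Ioi t) := by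
  obtain ⟨c, hc, hO⟩ := hg.inv_mul_decay
  exact integrableOn_Ioi_of_isBigO_exp hg.continuousOn_inv_mul hc hO ht

theorem hasDerivAt_tailInt_inv_mul (hg : Rapid g) {t : ℝ} (ht : 0 < t) :
    HasDerivAt (tailInt fun t => (t : ℂ)⁻¹ * g t) (-((t : ℂ)⁻¹ * g t)) t :=
  tailInt_hasDerivAt hg.continuousOn_inv_mul (fun _ => hg.integrableOn_inv_mul) ht

/-- Let P approximate g and let Q be an antiderivative of P/t in the span. The tail integral plus Q
has derivative (P - g)/t = O(t^R), integrable at 0, so it tends to a constant C, and C - Q is the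
required approximation. -/
theorem hasLogExpansion_tailInt (hg : Rapid g) :
    HasLogExpansion (tailInt fun t => (t : ℂ)⁻¹ * g t) := by
  intro R
  obtain ⟨P, hP, hO⟩ := hg.expansion (R + 1)
  obtain ⟨Q, hQ, hQd⟩ := logSpan_hasDerivAt_antideriv hP
  set r : ℝ → ℂ := fun u => (u : ℂ)⁻¹ * (P u - g u) with hr
  set D : ℝ → ℂ := fun t => tailInt (fun t => (t : ℂ)⁻¹ * g t) t + Q t with hD
  have hDd : ∀ t : ℝ, 0 < t → HasDerivAt D (r t) t := fun t ht =>
    ((hg.hasDerivAt_tailInt_inv_mul ht).add (hQd t ht)).congr_deriv (by simp only [hr]; ring)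
  have hrc : ContinuousOn r (Ioi 0) :=
    continuousOn_ofReal_inv.mul ((logSpan_continuousOn hP).sub hg.continuousOn)
  obtain ⟨K, hK0, hK⟩ := hO.exists_pos
  have hK := hK.bound
  rw [eventually_nhdsWithin_iff, Metric.eventually_nhds_iff] at hK
  obtain ⟨δ', hδ', hK⟩ := hK
  obtain ⟨δ, hδ0, hδ1, hδ⟩ : ∃ δ : ℝ, 0 < δ ∧ δ ≤ 1 ∧ δ < δ' :=
    ⟨min 1 (δ' / 2), by positivity, min_le_left _ _,
      lt_of_le_of_lt (min_le_right _ _) (by linarith)⟩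
  have hrb : ∀ u : ℝ, 0 < u → u ≤ δ → ‖r u‖ ≤ K * u ^ R := by
    intro u hu hu'
    have h := hK (y := u) (by rw [Real.dist_eq, sub_zero, abs_of_pos hu]; linarith) hu
    rw [Real.norm_of_nonneg (by positivity), norm_sub_rev] at h
    rw [hr, norm_mul, norm_inv, Complex.norm_real, Real.norm_of_nonneg hu.le]
    calc u⁻¹ * ‖P u - g u‖ ≤ u⁻¹ * (K * u ^ (R + 1)) := by gcongr
      _ = K * u ^ R := by field_simp; ring
  have hint : ∀ t : ℝ, t ≤ δ → 0 ≤ t → IntervalIntegrable r volume 0 t := by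
    intro t ht ht0
    rw [intervalIntegrable_iff_integrableOn_Ioc_of_le ht0]
    refine IntegrableOn.of_bound (C := K) (by simp)
      ((hrc.mono fun u hu => hu.1).aestronglyMeasurable measurableSet_Ioc) ?_
    filter_upwards [ae_restrict_mem measurableSet_Ioc] with u hu
    refine (hrb u hu.1 (hu.2.trans ht)).trans ?_
    exact mul_le_of_le_one_right hK0.le (pow_le_one₀ hu.1.le ((hu.2.trans ht).trans hδ1))
  -- This is the limit of D at 0⁺.
  set C : ℂ := D δ - ∫ u in (0 : ℝ)..δ, r u with hC
  refine ⟨(fun _ => C) - Q, logSpan.sub_mem (logSpan_const C) hQ, ?_⟩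
  refine Asymptotics.IsBigO.of_bound K ?_
  filter_upwards [Ioo_mem_nhdsGT hδ0] with t ht
  have h0t := hint t ht.2.le ht.1.le
  have h0δ := hint δ le_rfl hδ0.le
  have h1 : ∫ u in t..δ, r u = D δ - D t :=
    intervalIntegral.integral_eq_sub_of_hasDerivAt
      (fun u hu => hDd u (by rw [uIcc_of_le ht.2.le] at hu; exact lt_of_lt_of_le ht.1 hu.1))
      (h0t.symm.trans h0δ)
  have h2 := intervalIntegral.integral_add_adjacent_intervals h0t (h0t.symm.trans h0δ)
  have h3 : tailInt (fun t => (t : ℂ)⁻¹ * g t) t - ((fun _ => C) - Q : ℝ → ℂ) t =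
      ∫ u in (0 : ℝ)..t, r u := by
    have : D t = tailInt (fun t => (t : ℂ)⁻¹ * g t) t + Q t := rfl
    simp only [Pi.sub_apply]
    rw [hC, ← h2, h1, this]
    ring
  rw [h3, Real.norm_of_nonneg (pow_nonneg ht.1.le R)]
  have h4 : ‖∫ u in (0 : ℝ)..t, r u‖ ≤ K * t ^ R * |t - 0| := by
    refine intervalIntegral.norm_integral_le_of_norm_le_const fun u hu => ?_
    rw [uIoc_of_le ht.1.le] at hu
    refine (hrb u hu.1 (hu.2.trans ht.2.le)).trans ?_
    have := hu.1.le
    have := hu.2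
    gcongr
  refine h4.trans ?_
  rw [sub_zero, abs_of_pos ht.1]
  exact mul_le_of_le_one_right (by have := ht.1; positivity) (ht.2.le.trans hδ1)

theorem tailInt_inv_mul (hg : Rapid g) : Rapid (tailInt fun t => (t : ℂ)⁻¹ * g t) where
  continuousOn := fun _ ht => (hg.hasDerivAt_tailInt_inv_mul ht).continuousAt.continuousWithinAt
  expansion := hg.hasLogExpansion_tailInt
  decay := by
    obtain ⟨c, hc, hO⟩ := hg.inv_mul_decay
    exact ⟨c, hc, tailInt_isBigO_exp hc hO⟩

end Rapid

/-! ### The kernel `1 / (exp t - 1)` -/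

/-- The function `1 / (exp t - 1)`. -/
def bose (t : ℝ) : ℂ :=
  1 / (Complex.exp t - 1)

theorem cexp_sub_one_ne_zero {t : ℝ} (ht : 0 < t) : Complex.exp t - 1 ≠ 0 := by
  have : Real.exp t - 1 ≠ 0 := by
    have := Real.add_one_lt_exp ht.ne'
    linarith
  exact_mod_cast this

theorem bose_continuousOn : ContinuousOn bose (Ioi 0) := by
  unfold bose
  exact ContinuousOn.div (by fun_prop) (by fun_prop) fun t ht => cexp_sub_one_ne_zero ht

theorem bose_isBigO : bose =O[atTop] fun t : ℝ => Real.exp (-1 * t) := by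
  refine Asymptotics.IsBigO.of_bound 2 ?_
  filter_upwards [eventually_ge_atTop (1 : ℝ)] with t ht
  have h2 : 2 ≤ Real.exp t := by linarith [Real.add_one_le_exp t]
  have : bose t = ((1 / (Real.exp t - 1) : ℝ) : ℂ) := by simp [bose]
  rw [this, Complex.norm_real, Real.norm_of_nonneg (by apply div_nonneg <;> linarith),
    Real.norm_of_nonneg (Real.exp_pos _).le, neg_one_mul, Real.exp_neg, ← div_eq_mul_inv,
    div_le_div_iff₀ (by linarith) (by linarith)]
  linarith

/-- The factor t cancels the simple pole: the function is the inverse of (e^t - 1)/t, a difference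
quotient that is analytic at 0 with value 1. -/
theorem bose_hasLogExpansion : HasLogExpansion fun t => (t : ℂ) * bose t := by
  have hexp : AnalyticAt ℝ (fun t : ℝ => Complex.exp t) 0 := by
    have : AnalyticAt ℝ (fun t : ℝ => (t : ℂ)) 0 := Complex.ofRealCLM.analyticAt 0
    exact (analyticAt_cexp.restrictScalars (𝕜 := ℝ)).comp this
  have hds : AnalyticAt ℝ (dslope (fun t : ℝ => Complex.exp t) 0) 0 := by
    obtain ⟨p, hp⟩ := hexp
    exact ⟨_, hp.has_fpower_series_dslope_fslope⟩
  have h0 : dslope (fun t : ℝ => Complex.exp t) 0 0 ≠ 0 := by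
    rw [dslope_same]
    have : HasDerivAt (fun t : ℝ => Complex.exp t) 1 0 := by
      simpa using (Complex.hasDerivAt_exp (0 : ℝ)).comp_ofReal
    rw [this.deriv]
    exact one_ne_zero
  refine (HasLogExpansion.of_analyticAt (hds.inv h0)).congr fun t ht => ?_
  have ht0 : t ≠ 0 := ne_of_gt ht
  simp only [Pi.inv_apply]
  rw [dslope_of_ne _ ht0, slope_def_module]
  simp [bose, mul_comm]

theorem rapid_mul_bose : Rapid fun t => (t : ℂ) * bose t where
  continuousOn := ContinuousOn.mul (by fun_prop) bose_continuousOn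
  expansion := bose_hasLogExpansion
  decay := by
    refine ⟨1 / 2, by norm_num, ?_⟩
    refine ((Tame.ofReal.growth (1 / 2) (by norm_num)).mul bose_isBigO).congr_right fun t => ?_
    rw [← Real.exp_add]
    ring_nf

theorem bose_mul_eq (h : ℝ → ℂ) :
    EqOn (fun t => bose t * h t) (fun t => (t : ℂ)⁻¹ * (h t * (t * bose t))) (Ioi 0) := by
  intro t ht
  have : (t : ℂ) ≠ 0 := by exact_mod_cast (ne_of_gt ht : t ≠ 0)
  simp only
  field_simp

theorem eq_inv_mul_self (h : ℝ → ℂ) :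
    EqOn h (fun t => (t : ℂ)⁻¹ * (t * h t)) (Ioi 0) := by
  intro t ht
  have : (t : ℂ) ≠ 0 := by exact_mod_cast (ne_of_gt ht : t ≠ 0)
  simp only
  field_simp

/-- The operator `T h(t) = ∫_t^∞ h(u) / (exp u - 1) du`. -/
def boseInt (h : ℝ → ℂ) : ℝ → ℂ :=
  tailInt fun u => bose u * h u

namespace Tame

variable {g h : ℝ → ℂ}

/-- The pole of `bose` is traded for the measure du/u, under which tail integrals keep logarithmic
expansions. -/
theorem boseInt (hh : Tame h) : Rapid (boseInt h) :=
  (hh.mul_rapid rapid_mul_bose).tailInt_inv_mul.congr (tailInt_congr (bose_mul_eq h)).symm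

theorem integrableOn_bose_mul (hh : Tame h) {t : ℝ} (ht : 0 < t) :
    IntegrableOn (fun u => bose u * h u) (Ioi t) :=
  ((hh.mul_rapid rapid_mul_bose).integrableOn_inv_mul ht).congr_fun
    (fun _ hu => (bose_mul_eq h (lt_trans ht hu)).symm) measurableSet_Ioi

theorem continuousOn_bose_mul (hh : Tame h) : ContinuousOn (fun u => bose u * h u) (Ioi 0) :=
  bose_continuousOn.mul hh.continuousOn

theorem iterate_boseInt (hh : Tame h) (k : ℕ) : Tame (_root_.boseInt^[k] h) := by
  induction k with
  | zero => exact hh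
  | succ k ih => rw [Function.iterate_succ_apply']; exact ih.boseInt.tame

end Tame

namespace Rapid

variable {g h : ℝ → ℂ}

theorem tailInt (hh : Rapid h) : Rapid (tailInt h) :=
  (Tame.ofReal.mul_rapid hh).tailInt_inv_mul.congr (tailInt_congr (eq_inv_mul_self h)).symm

theorem iterate_tailInt (hh : Rapid h) (k : ℕ) : Rapid (_root_.tailInt^[k] h) := by
  induction k with
  | zero => exact hh
  | succ k ih => rw [Function.iterate_succ_apply']; exact ih.tailInt

end Rapid

/-! ### Meromorphic continuation from half-planes -/

theorem isOpen_re_gt (σ : ℝ) : IsOpen {s : ℂ | σ < s.re} :=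
  isOpen_lt continuous_const Complex.continuous_re

theorem isPreconnected_re_gt (σ : ℝ) : IsPreconnected {s : ℂ | σ < s.re} :=
  (convex_halfSpace_re_gt σ).isPreconnected

/-- Identity theorem: infinite order of F - G propagates along a preconnected set. Punctured
neighbourhoods are used because values at individual points of a merely meromorphic function carry
no information. -/
theorem MeromorphicOn.eventuallyEq_nhdsNE_of_isPreconnected {F G : ℂ → ℂ} {U : Set ℂ}
    (hU : IsPreconnected U) (hF : MeromorphicOn F U) (hG : MeromorphicOn G U) {z s : ℂ}
    (hz : z ∈ U) (hFG : F =ᶠ[𝓝[≠] z] G) (hs : s ∈ U) : F =ᶠ[𝓝[≠] s] G := by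
  have htop : meromorphicOrderAt (F - G) z = ⊤ := by
    rw [meromorphicOrderAt_eq_top_iff]
    filter_upwards [hFG] with w hw
    simp [hw]
  have hs' : meromorphicOrderAt (F - G) s = ⊤ := by
    by_contra h
    exact (hF.sub hG).meromorphicOrderAt_ne_top_of_isPreconnected hU hs hz h htop
  rw [meromorphicOrderAt_eq_top_iff] at hs'
  filter_upwards [hs'] with w hw
  exact sub_eq_zero.1 hw

theorem eventuallyEq_nhdsNE_of_re_gt {F G : ℂ → ℂ} {ρ σ : ℝ}
    (hF : MeromorphicOn F {s | ρ < s.re}) (hG : MeromorphicOn G {s | ρ < s.re})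
    (hFG : ∀ s : ℂ, σ < s.re → F =ᶠ[𝓝[≠] s] G) {s : ℂ} (hs : ρ < s.re) : F =ᶠ[𝓝[≠] s] G := by
  have hz : ρ < (((max ρ σ + 1 : ℝ) : ℂ)).re := by
    rw [Complex.ofReal_re]; linarith [le_max_left ρ σ]
  refine hF.eventuallyEq_nhdsNE_of_isPreconnected (isPreconnected_re_gt ρ) hG hz (hFG _ ?_) hs
  rw [Complex.ofReal_re]; linarith [le_max_right ρ σ]

theorem eventuallyEq_nhdsNE_of_eqOn {F G : ℂ → ℂ} {σ : ℝ} (hFG : EqOn F G {s | σ < s.re})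
    {s : ℂ} (hs : σ < s.re) : F =ᶠ[𝓝[≠] s] G := by
  refine eventually_nhdsWithin_of_eventually_nhds ?_
  filter_upwards [(isOpen_re_gt σ).mem_nhds hs] with z hz using hFG hz

/-- Continuations to the half-planes Re s > -R agree off isolated points by the identity theorem, so
they glue. -/
theorem exists_meromorphicOn_univ {f : ℂ → ℂ} {σ : ℝ}
    (h : ∀ R : ℕ, ∃ F : ℂ → ℂ, MeromorphicOn F {s | -(R : ℝ) < s.re} ∧
      EqOn F f {s | σ < s.re}) :
    ∃ F : ℂ → ℂ, MeromorphicOn F univ ∧ ∀ s : ℂ, σ < s.re → F =ᶠ[𝓝[≠] s] f := by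
  choose F hF hFf using h
  have hR : ∀ s : ℂ, ∃ R : ℕ, -(R : ℝ) < s.re := fun s => by
    obtain ⟨R, hR⟩ := exists_nat_gt (-s.re)
    exact ⟨R, by linarith⟩
  choose R hR using hR
  have hcomp : ∀ (R₁ R₂ : ℕ) (s : ℂ), -(R₁ : ℝ) < s.re → -(R₂ : ℝ) < s.re →
      F R₁ =ᶠ[𝓝[≠] s] F R₂ := by
    intro R₁ R₂ s h₁ h₂
    rcases le_total R₁ R₂ with h | h
    · refine eventuallyEq_nhdsNE_of_re_gt (hF R₁) ((hF R₂).mono_set fun z hz => ?_)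
        (fun _ => eventuallyEq_nhdsNE_of_eqOn ((hFf R₁).trans (hFf R₂).symm)) h₁
      have : (R₁ : ℝ) ≤ R₂ := by exact_mod_cast h
      exact lt_of_le_of_lt (by linarith) (show -(R₁ : ℝ) < z.re from hz)
    · refine eventuallyEq_nhdsNE_of_re_gt ((hF R₁).mono_set fun z hz => ?_) (hF R₂)
        (fun _ => eventuallyEq_nhdsNE_of_eqOn ((hFf R₁).trans (hFf R₂).symm)) h₂
      have : (R₂ : ℝ) ≤ R₁ := by exact_mod_cast h
      exact lt_of_le_of_lt (by linarith) (show -(R₂ : ℝ) < z.re from hz)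
  -- The normal form makes the value at s independent of the chosen half-plane.
  set G : ℂ → ℂ := fun s => toMeromorphicNFAt (F (R s)) s s with hG
  have hGF : ∀ (s : ℂ), G =ᶠ[𝓝[≠] s] F (R s) := by
    intro s
    have hm := (hF (R s)).toMeromorphicNFOn_eq_self_on_nhdsNE (hR s)
    have hU := eventually_nhdsWithin_of_eventually_nhds (s := {s}ᶜ)
      ((isOpen_re_gt (-(R s : ℝ))).mem_nhds (hR s))
    filter_upwards [hm, hU] with z hz hzU
    rw [← hz, toMeromorphicNFOn_eq_toMeromorphicNFAt (hF (R s)) hzU, hG]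
    exact (toMeromorphicNFAt_eventuallyEq_nhds_congr
      (hcomp (R z) (R s) z (hR z) hzU)).eq_of_nhds
  refine ⟨G, fun s _ => (hF (R s) s (hR s)).congr (hGF s).symm, fun s hs => ?_⟩
  exact (hGF s).trans (eventuallyEq_nhdsNE_of_eqOn (hFf _) hs)

/-- Agreement is only asked on Re s > τ, while f is holomorphic on Re s > σ. This serves ξ_MT, where
σ = 1 - j and the Mellin continuation is compared on Re s > 1. -/
theorem isMeromorphicContinuation_toMeromorphicNFOn {f G : ℂ → ℂ} {σ τ : ℝ}
    (hf : DifferentiableOn ℂ f {s | σ < s.re}) (hG : MeromorphicOn G univ)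
    (hGf : ∀ s : ℂ, τ < s.re → G =ᶠ[𝓝[≠] s] f) :
    IsMeromorphicContinuation σ f (toMeromorphicNFOn G univ) := by
  have hNF := meromorphicNFOn_toMeromorphicNFOn G univ
  have han : ∀ s : ℂ, σ < s.re → AnalyticAt ℂ f s := fun s hs =>
    hf.analyticAt ((isOpen_re_gt σ).mem_nhds hs)
  refine ⟨hf, fun s hs => ?_, hNF⟩
  have hmf : MeromorphicOn f {s | σ < s.re} := fun s hs => (han s hs).meromorphicAt
  have hev : G =ᶠ[𝓝[≠] s] f :=
    eventuallyEq_nhdsNE_of_re_gt (hG.mono_set (subset_univ _)) hmf hGf hs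
  have h1 := (hG.toMeromorphicNFOn_eq_self_on_nhdsNE (mem_univ s)).trans hev
  exact (((hNF (mem_univ s)).eventuallyEq_nhdsNE_iff_eventuallyEq_nhds
    (han s hs).meromorphicNFAt).1 h1).eq_of_nhds

/-! ### Mellin transforms of functions with logarithmic expansions -/

theorem isBigO_atTop_indicator_Ioc (P : ℝ → ℂ) (g : ℝ → ℝ) :
    indicator (Ioc 0 1) P =O[atTop] g := by
  refine (Asymptotics.isBigO_zero g atTop).congr' ?_ EventuallyEq.rfl
  filter_upwards [eventually_gt_atTop (1 : ℝ)] with t ht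
  rw [indicator_of_notMem fun h => absurd h.2 (not_le.2 ht)]

theorem indicator_Ioc_eventuallyEq (P : ℝ → ℂ) : indicator (Ioc 0 1) P =ᶠ[𝓝[>] 0] P := by
  filter_upwards [Ioo_mem_nhdsGT (zero_lt_one (α := ℝ))] with t ht
  rw [indicator_of_mem (Set.mem_Ioc.2 ⟨ht.1, ht.2.le⟩)]

theorem locallyIntegrableOn_indicator {P : ℝ → ℂ} (hP : ContinuousOn P (Ioi 0)) :
    LocallyIntegrableOn (indicator (Ioc 0 1) P) (Ioi 0) := by
  intro x hx
  obtain ⟨U, hU, hi⟩ := (hP.locallyIntegrableOn (μ := volume) measurableSet_Ioi) x hx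
  exact ⟨U, hU, hi.indicator measurableSet_Ioc⟩

theorem logSpan_mellin_hasDerivAt {P : ℝ → ℂ} (hP : P ∈ logSpan) {s : ℂ} (hs : 0 < s.re) :
    MellinConvergent (indicator (Ioc 0 1) P) s ∧ HasDerivAt (mellin (indicator (Ioc 0 1) P))
      (mellin (fun t => Real.log t • indicator (Ioc 0 1) P t) s) s := by
  have hb : indicator (Ioc 0 1) P =O[𝓝[>] 0] fun t : ℝ => t ^ (-(s.re / 2)) :=
    (logSpan_isBigO hP (half_pos hs)).congr' (indicator_Ioc_eventuallyEq P).symm EventuallyEq.rfl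
  have hl := locallyIntegrableOn_indicator (logSpan_continuousOn hP)
  exact ⟨mellinConvergent_of_isBigO_rpow (a := s.re + 1) hl (isBigO_atTop_indicator_Ioc P _)
      (by linarith) hb (by linarith),
    (mellin_hasDerivAt_of_isBigO_rpow (a := s.re + 1) hl (isBigO_atTop_indicator_Ioc P _)
      (by linarith) hb (by linarith)).2⟩

/-- Differentiating ∫₀¹ t^{s+i-1} dt = 1/(s+i) in s inserts one factor log t each time. -/
theorem mellin_indicator_logMonomial (i j : ℕ) {s : ℂ} (hs : 0 < s.re) :
    mellin (indicator (Ioc 0 1) (logMonomial i j)) s =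
      (-1) ^ j * (j ! : ℂ) * ((s + i) ^ (j + 1))⁻¹ := by
  induction j generalizing s with
  | zero =>
    have h := (hasMellin_cpow_Ioc (i : ℂ) (s := s) (by simp; positivity)).2
    have : logMonomial i 0 = fun t : ℝ => (t : ℂ) ^ (i : ℂ) := by
      funext t; simp [logMonomial]
    rw [this, h]
    simp
  | succ j ih =>
    have h := (logSpan_mellin_hasDerivAt (logMonomial_mem i j) hs).2
    have hne : s + i ≠ 0 := fun h0 => by
      have := congrArg Complex.re h0
      simp at this
      have hi : (0 : ℝ) ≤ i := Nat.cast_nonneg i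
      linarith
    have hd : HasDerivAt (fun z : ℂ => (-1) ^ j * (j ! : ℂ) * ((z + i) ^ (j + 1))⁻¹)
        ((-1) ^ j * (j ! : ℂ) * (-(((j + 1 : ℕ) : ℂ) * (s + i) ^ j * 1) /
          ((s + i) ^ (j + 1)) ^ 2)) s :=
      ((((hasDerivAt_id s).add_const (i : ℂ)).fun_pow (j + 1)).fun_inv
        (pow_ne_zero _ hne)).const_mul _
    have hd' : HasDerivAt (mellin (indicator (Ioc 0 1) (logMonomial i j))) _ s :=
      hd.congr_of_eventuallyEq (by
        filter_upwards [(isOpen_re_gt 0).mem_nhds hs] with z hz using ih hz)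
    have hlog : (fun t => Real.log t • indicator (Ioc 0 1) (logMonomial i j) t) =
        indicator (Ioc 0 1) (logMonomial i (j + 1)) := by
      funext t
      by_cases ht : t ∈ Set.Ioc (0 : ℝ) 1
      · rw [indicator_of_mem ht, indicator_of_mem ht, Complex.real_smul]
        simp only [logMonomial]
        ring
      · rw [indicator_of_notMem ht, indicator_of_notMem ht, smul_zero]
    rw [← hlog, h.unique hd', Nat.factorial_succ]
    push_cast
    field_simp
    ring

theorem logSpan_exists_meromorphicOn {P : ℝ → ℂ} (hP : P ∈ logSpan) :
    ∃ Q : ℂ → ℂ, MeromorphicOn Q univ ∧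
      ∀ s : ℂ, 0 < s.re → mellin (indicator (Ioc 0 1) P) s = Q s := by
  induction hP using logSpan_induction with
  | mono i j =>
    refine ⟨fun s => (-1) ^ j * (j ! : ℂ) * ((s + i) ^ (j + 1))⁻¹, ?_,
      fun s hs => mellin_indicator_logMonomial i j hs⟩
    intro s _
    fun_prop
  | zero =>
    refine ⟨0, fun s _ => MeromorphicAt.const 0 s, fun s _ => ?_⟩
    simp [mellin]
  | add f g hf hg ihf ihg =>
    obtain ⟨Q, hQ, hQe⟩ := ihf
    obtain ⟨Q', hQ', hQe'⟩ := ihg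
    refine ⟨Q + Q', hQ.add hQ', fun s hs => ?_⟩
    have h := (hasMellin_add (logSpan_mellin_hasDerivAt hf hs).1
      (logSpan_mellin_hasDerivAt hg hs).1).2
    rw [Pi.add_apply, ← hQe s hs, ← hQe' s hs, ← h, indicator_add']
    rfl
  | smul c f hf ihf =>
    obtain ⟨Q, hQ, hQe⟩ := ihf
    refine ⟨fun s => c * Q s, fun s hs => (MeromorphicAt.const c s).mul (hQ s hs), fun s hs => ?_⟩
    have h := mellin_const_smul (indicator (Ioc 0 1) f) s c
    simp only
    rw [← hQe s hs, ← smul_eq_mul, ← h]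
    congr 1
    funext t
    simp [indicator_apply]

/-! ### Continuation of Mellin transforms. -/

namespace Rapid

variable {h : ℝ → ℂ}

theorem locallyIntegrableOn (hh : Rapid h) : LocallyIntegrableOn h (Ioi 0) :=
  hh.continuousOn.locallyIntegrableOn measurableSet_Ioi

theorem mellinConvergent (hh : Rapid h) {s : ℂ} (hs : 0 < s.re) : MellinConvergent h s := by
  obtain ⟨c, hc, hO⟩ := hh.decay
  exact mellinConvergent_of_isBigO_rpow_exp hc hh.locallyIntegrableOn hO
    (hh.expansion.isBigO (half_pos hs)) (by linarith)

/-- Subtracting P on (0, 1] leaves a function that is O(t^R) at 0 and decays exponentially, so its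
Mellin transform is holomorphic for Re s > -R; the subtracted part has an explicit meromorphic
transform. -/
theorem exists_meromorphicOn_re_gt (hh : Rapid h) (R : ℕ) :
    ∃ F : ℂ → ℂ, MeromorphicOn F {s | -(R : ℝ) < s.re} ∧ EqOn F (mellin h) {s | 0 < s.re} := by
  obtain ⟨P, hP, hPO⟩ := hh.expansion R
  obtain ⟨Q, hQ, hQe⟩ := logSpan_exists_meromorphicOn hP
  obtain ⟨c, hc, hO⟩ := hh.decay
  set k : ℝ → ℂ := fun t => h t - indicator (Ioc 0 1) P t with hk
  have hkl : LocallyIntegrableOn k (Ioi 0) :=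
    hh.locallyIntegrableOn.sub (locallyIntegrableOn_indicator (logSpan_continuousOn hP))
  have hkt : k =O[atTop] fun t : ℝ => Real.exp (-c * t) :=
    hO.sub (isBigO_atTop_indicator_Ioc P _)
  have hkb : k =O[𝓝[>] 0] fun t : ℝ => t ^ (-(-(R : ℝ))) := by
    refine hPO.congr' ?_ ?_
    · filter_upwards [indicator_Ioc_eventuallyEq P] with t ht
      simp only [hk, ht]
    · filter_upwards with t
      rw [neg_neg, Real.rpow_natCast]
  have hd : DifferentiableOn ℂ (mellin k) {s | -(R : ℝ) < s.re} := fun s hs =>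
    (mellin_differentiableAt_of_isBigO_rpow_exp hc hkl hkt hkb hs).differentiableWithinAt
  refine ⟨fun s => Q s + mellin k s, fun s hs => ?_, fun s hs => ?_⟩
  · exact (hQ s (mem_univ s)).add
      (hd.analyticAt ((isOpen_re_gt _).mem_nhds hs)).meromorphicAt
  · have h1 := (hasMellin_sub (hh.mellinConvergent hs) (logSpan_mellin_hasDerivAt hP hs).1).2
    simp only
    rw [h1, ← hQe s hs]
    ring

/-- The Mellin transform of a rapidly decaying function with a logarithmic expansion at `0`
extends to a meromorphic function on `ℂ`. -/
theorem exists_meromorphicOn (hh : Rapid h) :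
    ∃ F : ℂ → ℂ, MeromorphicOn F univ ∧ ∀ s : ℂ, 0 < s.re → F =ᶠ[𝓝[≠] s] mellin h :=
  exists_meromorphicOn_univ hh.exists_meromorphicOn_re_gt

theorem differentiableAt_mellin (hh : Rapid h) {s : ℂ} (hs : 0 < s.re) :
    DifferentiableAt ℂ (mellin h) s := by
  obtain ⟨c, hc, hO⟩ := hh.decay
  exact mellin_differentiableAt_of_isBigO_rpow_exp hc hh.locallyIntegrableOn hO
    (hh.expansion.isBigO (half_pos hs)) (by linarith)

end Rapid

theorem mellin_congr {f g : ℝ → ℂ} (hfg : EqOn f g (Ioi 0)) (s : ℂ) : mellin f s = mellin g s :=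
  setIntegral_congr_fun measurableSet_Ioi fun t ht => by simp only [hfg ht]

theorem MellinConvergent.congr {f g : ℝ → ℂ} {s : ℂ} (hf : MellinConvergent f s)
    (hfg : EqOn f g (Ioi 0)) : MellinConvergent g s :=
  IntegrableOn.congr_fun hf (fun t ht => by simp only [hfg ht]) measurableSet_Ioi

theorem mellin_sum {ι : Type*} (S : Finset ι) {f : ι → ℝ → ℂ} {s : ℂ}
    (hf : ∀ i ∈ S, MellinConvergent (f i) s) :
    mellin (fun t => ∑ i ∈ S, f i t) s = ∑ i ∈ S, mellin (f i) s := by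
  simp only [mellin, Finset.smul_sum]
  exact integral_finsetSum S hf

theorem mellin_const_mul (c : ℂ) (f : ℝ → ℂ) (s : ℂ) :
    mellin (fun t => c * f t) s = c * mellin f s :=
  mellin_const_smul f s c

theorem bose_mul_eq_cpow (h : ℝ → ℂ) :
    EqOn (fun t : ℝ => (t : ℂ) ^ (-1 : ℂ) • (h t * (t * bose t))) (fun t => bose t * h t) (Ioi 0) := by
  intro t ht
  rw [bose_mul_eq h ht]
  simp only [smul_eq_mul, Complex.cpow_neg_one]

theorem mellin_bose_mul (h : ℝ → ℂ) (s : ℂ) :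
    mellin (fun t => bose t * h t) s = mellin (fun t => h t * (t * bose t)) (s - 1) := by
  rw [← mellin_congr (bose_mul_eq_cpow h), mellin_cpow_smul, sub_eq_add_neg]

namespace Tame

variable {h : ℝ → ℂ}

theorem mellinConvergent_bose_mul (hh : Tame h) {s : ℂ} (hs : 1 < s.re) :
    MellinConvergent (fun t => bose t * h t) s := by
  refine MellinConvergent.congr ?_ (bose_mul_eq_cpow h)
  rw [MellinConvergent.cpow_smul]
  exact (hh.mul_rapid rapid_mul_bose).mellinConvergent (by simp; linarith)

theorem differentiableOn_mellin_bose_mul (hh : Tame h) :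
    DifferentiableOn ℂ (mellin fun t => bose t * h t) {s | 1 < s.re} := by
  intro s hs
  have : (mellin fun t => bose t * h t) =
      fun s => mellin (fun t => h t * (t * bose t)) (s - 1) := funext (mellin_bose_mul h)
  rw [this]
  have hs' : 0 < (s - 1).re := by
    have : 1 < s.re := hs
    simp; linarith
  have hd := (hh.mul_rapid rapid_mul_bose).differentiableAt_mellin hs'
  exact (DifferentiableAt.comp s (f := fun z : ℂ => z - 1) hd (by fun_prop)).differentiableWithinAt

theorem exists_meromorphicOn_bose_mul (hh : Tame h) :
    ∃ F : ℂ → ℂ, MeromorphicOn F univ ∧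
      ∀ s : ℂ, 1 < s.re → F =ᶠ[𝓝[≠] s] mellin fun t => bose t * h t := by
  obtain ⟨F, hF, hFe⟩ := (hh.mul_rapid rapid_mul_bose).exists_meromorphicOn
  have hmap : ∀ s : ℂ, Tendsto (fun z : ℂ => z - 1) (𝓝[≠] s) (𝓝[≠] (s - 1)) := fun s =>
    tendsto_nhdsWithin_of_tendsto_nhds_of_eventually_within _
      ((by fun_prop : Continuous fun z : ℂ => z - 1).tendsto s |>.mono_left nhdsWithin_le_nhds)
      (by filter_upwards [self_mem_nhdsWithin] with z hz using fun h => hz (sub_left_inj.1 h))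
  refine ⟨fun s => F (s - 1), fun s _ => ?_, fun s hs => ?_⟩
  · exact (hF (s - 1) (mem_univ _)).comp_analyticAt (g := fun z : ℂ => z - 1) (by fun_prop)
  · have := (hmap s).eventually (hFe (s - 1) (by simp; linarith))
    filter_upwards [this] with z hz
    rw [hz, mellin_bose_mul]

end Tame

/-! ### Linearity and integration by parts -/

theorem boseInt_congr {g h : ℝ → ℂ} (hgh : EqOn g h (Ioi 0)) :
    EqOn (boseInt g) (boseInt h) (Ioi 0) :=
  tailInt_congr fun t ht => by simp only [hgh ht]

theorem iterate_boseInt_congr {g h : ℝ → ℂ} (hgh : EqOn g h (Ioi 0)) (k : ℕ) :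
    EqOn (boseInt^[k] g) (boseInt^[k] h) (Ioi 0) := by
  induction k with
  | zero => exact hgh
  | succ k ih => simpa only [Function.iterate_succ_apply'] using boseInt_congr ih

theorem boseInt_sum {ι : Type*} (S : Finset ι) (c : ι → ℂ) {f : ι → ℝ → ℂ}
    (hf : ∀ i ∈ S, Tame (f i)) :
    EqOn (boseInt fun t => ∑ i ∈ S, c i * f i t) (fun t => ∑ i ∈ S, c i * boseInt (f i) t)
      (Ioi 0) := by
  intro t ht
  simp only [boseInt, tailInt, Finset.mul_sum, ← integral_const_mul]
  rw [integral_finsetSum]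
  · refine Finset.sum_congr rfl fun i _ => integral_congr_ae (Eventually.of_forall fun u => ?_)
    simp only
    ring
  · intro i hi
    refine (((hf i hi).integrableOn_bose_mul ht).const_mul (c i)).congr
      (Eventually.of_forall fun u => ?_)
    simp only
    ring

theorem iterate_boseInt_sum {ι : Type*} (S : Finset ι) (c : ι → ℂ) {f : ι → ℝ → ℂ}
    (hf : ∀ i ∈ S, Tame (f i)) (k : ℕ) :
    EqOn (boseInt^[k] fun t => ∑ i ∈ S, c i * f i t)
      (fun t => ∑ i ∈ S, c i * boseInt^[k] (f i) t) (Ioi 0) := by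
  induction k with
  | zero => exact fun _ _ => rfl
  | succ k ih =>
    simp only [Function.iterate_succ_apply']
    exact (boseInt_congr ih).trans (boseInt_sum S c fun i hi => (hf i hi).iterate_boseInt k)

/-- Continuous functions on `(0, ∞)` with exponential decay at infinity. -/
structure ExpDecay (h : ℝ → ℂ) : Prop where
  continuousOn : ContinuousOn h (Ioi 0)
  decay : ∃ c : ℝ, 0 < c ∧ h =O[atTop] fun t : ℝ => Real.exp (-c * t)

/-- The product may have a pole at 0, hence the class with no condition there; integration by parts
on (t, ∞) needs none. -/
theorem Tame.expDecay_bose_mul {h : ℝ → ℂ} (hh : Tame h) : ExpDecay fun t => bose t * h t where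
  continuousOn := hh.continuousOn_bose_mul
  decay := by
    refine ⟨1 / 2, by norm_num, (bose_isBigO.mul
      (hh.growth (1 / 2) (by norm_num))).congr_right fun t => ?_⟩
    rw [← Real.exp_add]
    ring_nf

/-! ### Repeated integration by parts for tail integrals. -/

namespace ExpDecay

variable {h : ℝ → ℂ}

theorem integrableOn (hh : ExpDecay h) {t : ℝ} (ht : 0 < t) : IntegrableOn h (Ioi t) := by
  obtain ⟨c, hc, hO⟩ := hh.decay
  exact integrableOn_Ioi_of_isBigO_exp hh.continuousOn hc hO ht

theorem hasDerivAt_tailInt (hh : ExpDecay h) {t : ℝ} (ht : 0 < t) :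
    HasDerivAt (tailInt h) (-h t) t :=
  tailInt_hasDerivAt hh.continuousOn (fun _ => hh.integrableOn) ht

theorem tailInt (hh : ExpDecay h) : ExpDecay (tailInt h) where
  continuousOn := fun _ ht => (hh.hasDerivAt_tailInt ht).continuousAt.continuousWithinAt
  decay := by
    obtain ⟨c, hc, hO⟩ := hh.decay
    exact ⟨c, hc, tailInt_isBigO_exp hc hO⟩

theorem pow_mul (hh : ExpDecay h) (n : ℕ) : ExpDecay fun t => (t : ℂ) ^ n * h t where
  continuousOn := ContinuousOn.mul (by fun_prop) hh.continuousOn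
  decay := by
    obtain ⟨c, hc, hO⟩ := hh.decay
    refine ⟨c / 2, half_pos hc, (((Tame.ofReal_pow n).growth (c / 2) (half_pos hc)).mul
      hO).congr_right fun t => ?_⟩
    rw [← Real.exp_add]
    ring_nf

theorem tendsto_zero (hh : ExpDecay h) : Tendsto h atTop (𝓝 0) := by
  obtain ⟨c, hc, hO⟩ := hh.decay
  refine hO.trans_tendsto ?_
  exact Real.tendsto_exp_atBot.comp (tendsto_id.const_mul_atTop_of_neg (by linarith))

theorem tailInt_pow_succ_mul (hh : ExpDecay h) (n : ℕ) {t : ℝ} (ht : 0 < t) :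
    _root_.tailInt (fun u => (u : ℂ) ^ (n + 1) * h u) t =
      (t : ℂ) ^ (n + 1) * _root_.tailInt h t +
        ((n : ℂ) + 1) * _root_.tailInt (fun u => (u : ℂ) ^ n * _root_.tailInt h u) t := by
  have hi1 := (hh.pow_mul (n + 1)).integrableOn ht
  have hi2 := ((hh.tailInt.pow_mul n).integrableOn ht).const_mul ((n : ℂ) + 1)
  have hd : ∀ u : ℝ, 0 < u →
      HasDerivAt (fun u : ℝ => -((u : ℂ) ^ (n + 1) * _root_.tailInt h u))
        ((u : ℂ) ^ (n + 1) * h u - ((n : ℂ) + 1) * ((u : ℂ) ^ n * _root_.tailInt h u)) u := by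
    intro u hu
    have h1 : HasDerivAt (fun t : ℝ => (t : ℂ) ^ (n + 1)) (((n : ℂ) + 1) * (u : ℂ) ^ n) u :=
      (((hasDerivAt_id u).ofReal_comp).fun_pow (n + 1)).congr_deriv (by simp)
    refine (h1.mul (hh.hasDerivAt_tailInt hu)).neg.congr_deriv ?_
    ring
  have hlim : Tendsto (fun u : ℝ => -((u : ℂ) ^ (n + 1) * _root_.tailInt h u)) atTop (𝓝 0) := by
    simpa using (hh.tailInt.pow_mul (n + 1)).tendsto_zero.neg
  have key := integral_Ioi_of_hasDerivAt_of_tendsto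
    (hd t ht).continuousAt.continuousWithinAt (fun u hu => hd u (lt_trans ht hu))
    (hi1.sub hi2) hlim
  rw [integral_sub hi1 hi2, integral_const_mul] at key
  simp only [_root_.tailInt] at key ⊢
  linear_combination key

/-- Each integration by parts produces a boundary term and lowers the power by one, with h replaced
by its tail integral; the falling factors multiply to n!/q! when t^q is left. -/
theorem tailInt_pow_mul (hh : ExpDecay h) (n : ℕ) :
    EqOn (_root_.tailInt fun u => (u : ℂ) ^ n * h u)
      (fun t => ∑ p ∈ antidiagonal n,
        ((n ! : ℂ) / (p.2 ! : ℂ)) * ((t : ℂ) ^ p.2 * _root_.tailInt^[p.1 + 1] h t)) (Ioi 0) := by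
  induction n generalizing h with
  | zero => intro t _; simp
  | succ n ih =>
    intro t ht
    simp only
    rw [hh.tailInt_pow_succ_mul n ht, ih hh.tailInt ht, Finset.Nat.sum_antidiagonal_succ,
      Finset.mul_sum]
    congr 1
    · simp [div_self (Nat.cast_ne_zero.2 (Nat.factorial_ne_zero (n + 1)) : ((n + 1)! : ℂ) ≠ 0)]
    · refine Finset.sum_congr rfl fun p _ => ?_
      simp only [Function.iterate_succ_apply, Nat.factorial_succ]
      push_cast
      ring

end ExpDecay

/-! ### Iterated integrals attached to the Miyagawa series -/

/-- The iterated integral obtained from `h` by alternately multiplying by `1 / (exp t - 1)` and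
taking `b₀ + 1`, …, `b_{k-1} + 1` tail integrals. -/
def chainInt : (k : ℕ) → (Fin (k + 1) → ℕ) → (ℝ → ℂ) → ℝ → ℂ
  | 0, _, h => h
  | k + 1, b, h => chainInt k (Fin.tail b) (tailInt^[b 0 + 1] fun t => bose t * h t)

theorem Tame.iterate_tailInt_bose_mul {h : ℝ → ℂ} (hh : Tame h) (n : ℕ) :
    Tame (tailInt^[n + 1] fun t => bose t * h t) :=
  (hh.boseInt.iterate_tailInt n).tame

theorem Tame.chainInt {h : ℝ → ℂ} (hh : Tame h) {k : ℕ} (b : Fin (k + 1) → ℕ) :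
    Tame (chainInt k b h) := by
  induction k generalizing h with
  | zero => exact hh
  | succ k ih => exact ih (hh.iterate_tailInt_bose_mul _) (Fin.tail b)

theorem sum_antidiagonalTuple_succ {α : Type*} [AddCommMonoid α] (k n : ℕ)
    (f : (Fin (k + 1) → ℕ) → α) :
    ∑ b ∈ Finset.Nat.antidiagonalTuple (k + 1) n, f b =
      ∑ p ∈ antidiagonal n, ∑ b ∈ Finset.Nat.antidiagonalTuple k p.2, f (Fin.cons p.1 b) := by
  rw [Finset.sum_sigma']
  symm
  refine Finset.sum_bij' (fun x _ => Fin.cons x.1.1 x.2)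
    (fun b _ => ⟨(b 0, ∑ i, b (Fin.succ i)), Fin.tail b⟩) ?_ ?_ ?_ ?_ ?_
  · rintro ⟨⟨i, j⟩, b⟩ h
    simp only [Finset.mem_sigma, HasAntidiagonal.mem_antidiagonal, Finset.Nat.mem_antidiagonalTuple] at h ⊢
    rw [Fin.sum_univ_succ]
    simp [h.2, h.1]
  · intro b h
    simp only [Finset.mem_sigma, HasAntidiagonal.mem_antidiagonal, Finset.Nat.mem_antidiagonalTuple] at h ⊢
    rw [Fin.sum_univ_succ] at h
    exact ⟨h, rfl⟩
  · rintro ⟨⟨i, j⟩, b⟩ h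
    simp only [Finset.mem_sigma, HasAntidiagonal.mem_antidiagonal, Finset.Nat.mem_antidiagonalTuple] at h
    simp [h.2]
  · intro b _
    exact Fin.cons_self_tail b
  · intro x _
    rfl

/-- Each of the k operators absorbs part of the degree n as additional tail integrals and passes the
rest on. The factorial quotients telescope, so only the last entry of b appears in the coefficient;
`chainInt` itself ignores that entry. -/
theorem iterate_boseInt_pow_mul {h : ℝ → ℂ} (hh : Tame h) (k n : ℕ) :
    EqOn (boseInt^[k] fun t => (t : ℂ) ^ n * h t)
      (fun t => ∑ b ∈ Finset.Nat.antidiagonalTuple (k + 1) n,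
        ((n ! : ℂ) / ((b (Fin.last k))! : ℂ)) *
          ((t : ℂ) ^ b (Fin.last k) * chainInt k b h t)) (Ioi 0) := by
  induction k generalizing h n with
  | zero =>
    intro t _
    simp [chainInt, div_self (Nat.cast_ne_zero.2 (Nat.factorial_ne_zero n) : (n ! : ℂ) ≠ 0)]
  | succ k ih =>
    have h1 : EqOn (boseInt fun t => (t : ℂ) ^ n * h t)
        (fun t => ∑ p ∈ antidiagonal n, ((n ! : ℂ) / (p.2 ! : ℂ)) *
          ((t : ℂ) ^ p.2 * tailInt^[p.1 + 1] (fun t => bose t * h t) t)) (Ioi 0) := by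
      refine EqOn.trans (tailInt_congr fun t _ => ?_) (hh.expDecay_bose_mul.tailInt_pow_mul n)
      simp only
      ring
    intro t ht
    rw [Function.iterate_succ_apply, iterate_boseInt_congr h1 k ht,
      iterate_boseInt_sum _ _ (fun p _ => (Tame.ofReal_pow p.2).mul
        (hh.iterate_tailInt_bose_mul p.1)) k ht]
    simp only
    rw [sum_antidiagonalTuple_succ]
    refine Finset.sum_congr rfl fun p _ => ?_
    rw [ih (hh.iterate_tailInt_bose_mul p.1) p.2 ht, Finset.mul_sum]
    refine Finset.sum_congr rfl fun b _ => ?_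
    have hlast : (Fin.cons p.1 b : Fin (k + 2) → ℕ) (Fin.last (k + 1)) = b (Fin.last k) := by
      rw [← Fin.succ_last, Fin.cons_succ]
    have hp : (p.2 ! : ℂ) ≠ 0 := Nat.cast_ne_zero.2 (Nat.factorial_ne_zero _)
    rw [hlast]
    simp only [chainInt, Fin.cons_zero, Fin.tail_cons]
    field_simp

/-! ### Series in powers of a function -/

theorem HasSum.congr_apply {ι : Type*} {f g : ι → ℂ} {x : ℂ} (hf : HasSum f x)
    (h : ∀ i, f i = g i) : HasSum g x :=
  funext h ▸ hf

/-- `F(t) = ∑ i, a i * r(t) ^ p i` for all `t > 0`, with nonnegative coefficients. -/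
structure HasPowSeries {ι : Type*} (r : ℝ → ℝ) (a : ι → ℝ) (p : ι → ℕ) (F : ℝ → ℂ) : Prop where
  nonneg : ∀ i, 0 ≤ a i
  hasSum : ∀ t : ℝ, 0 < t → HasSum (fun i => ((a i * r t ^ p i : ℝ) : ℂ)) (F t)

namespace HasPowSeries

variable {ι κ : Type*} {r : ℝ → ℝ} {a : ι → ℝ} {p : ι → ℕ} {F : ℝ → ℂ}
  {b : κ → ℝ} {q : κ → ℕ} {G : ℝ → ℂ}

theorem summable (hF : HasPowSeries r a p F) {t : ℝ} (ht : 0 < t) :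
    Summable fun i => a i * r t ^ p i :=
  Complex.summable_ofReal.1 (hF.hasSum t ht).summable

theorem congr (hF : HasPowSeries r a p F) (hFG : EqOn F G (Ioi 0)) : HasPowSeries r a p G :=
  ⟨hF.nonneg, fun t ht => hFG ht ▸ hF.hasSum t ht⟩

theorem reindex (hF : HasPowSeries r a p F) (e : κ ≃ ι) (hb : ∀ x, b x = a (e x))
    (hq : ∀ x, q x = p (e x)) : HasPowSeries r b q F := by
  refine ⟨fun x => hb x ▸ hF.nonneg _, fun t ht => ?_⟩
  refine (e.hasSum_iff.2 (hF.hasSum t ht)).congr_apply fun x => ?_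
  simp only [Function.comp, hb, hq]

theorem mul (hF : HasPowSeries r a p F) (hG : HasPowSeries r b q G) :
    HasPowSeries r (fun x : ι × κ => a x.1 * b x.2) (fun x => p x.1 + q x.2)
      (fun t => F t * G t) := by
  refine ⟨fun x => mul_nonneg (hF.nonneg x.1) (hG.nonneg x.2), fun t ht => ?_⟩
  have hs : Summable fun x : ι × κ =>
      ((a x.1 * r t ^ p x.1 : ℝ) : ℂ) * ((b x.2 * r t ^ q x.2 : ℝ) : ℂ) :=
    summable_mul_of_summable_norm (f := fun i => ((a i * r t ^ p i : ℝ) : ℂ))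
      (g := fun i => ((b i * r t ^ q i : ℝ) : ℂ))
      (hF.hasSum t ht).summable.norm (hG.hasSum t ht).summable.norm
  have h := (hF.hasSum t ht).mul (hG.hasSum t ht) hs
  have hx : ∀ x : ι × κ, ((a x.1 * r t ^ p x.1 : ℝ) : ℂ) * ((b x.2 * r t ^ q x.2 : ℝ) : ℂ) =
      ((a x.1 * b x.2 * r t ^ (p x.1 + q x.2) : ℝ) : ℂ) := fun x => by
    rw [← Complex.ofReal_mul, pow_add]
    congr 1
    ring
  simpa only [hx] using h

theorem pi {n : ℕ} {a : Fin n → κ → ℝ} {p : κ → ℕ} {F : Fin n → ℝ → ℂ}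
    (hF : ∀ v, HasPowSeries r (a v) p (F v)) :
    HasPowSeries r (fun m : Fin n → κ => ∏ v, a v (m v)) (fun m => ∑ v, p (m v))
      (fun t => ∏ v, F v t) := by
  induction n with
  | zero =>
    refine ⟨fun m => by simp, fun t ht => ?_⟩
    convert hasSum_fintype (fun _ : Fin 0 → κ => (1 : ℂ)) using 2 <;> simp
  | succ n ih =>
    have h := ((hF 0).mul (ih fun v => hF v.succ)).reindex (Fin.consEquiv fun _ => κ).symm
      (b := fun m : Fin (n + 1) → κ => ∏ v, a v (m v)) (q := fun m => ∑ v, p (m v))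
      (fun m => by rw [Fin.prod_univ_succ]; rfl) (fun m => by rw [Fin.sum_univ_succ]; rfl)
    exact h.congr fun t _ => by simp only [Fin.prod_univ_succ]

end HasPowSeries

/-! ### Series of exponentials -/

/-- `F(t) = ∑ i, a i * exp (- p i * t)` for all `t > 0`, with nonnegative coefficients. -/
abbrev HasExpSeries {ι : Type*} (a : ι → ℝ) (p : ι → ℕ) (F : ℝ → ℂ) : Prop :=
  HasPowSeries (fun t => Real.exp (-t)) a p F

theorem exp_neg_pow (p : ℕ) (t : ℝ) : Real.exp (-t) ^ p = Real.exp (-(p : ℝ) * t) := by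
  rw [← Real.exp_nat_mul]
  ring_nf

theorem hasExpSeries_bose : HasExpSeries (fun _ : ℕ+ => 1) (fun m => (m : ℕ)) bose := by
  refine ⟨fun _ => zero_le_one, fun t ht => ?_⟩
  have h1 : Real.exp (-t) < 1 := by simpa using ht
  have h := ((hasSum_geometric_of_lt_one (Real.exp_pos (-t)).le h1).mul_left (Real.exp (-t)))
  have h2 : Real.exp (-t) * (1 - Real.exp (-t))⁻¹ = 1 / (Real.exp t - 1) := by
    rw [Real.exp_neg]
    have : Real.exp t ≠ 0 := (Real.exp_pos t).ne'
    have h3 : Real.exp t - 1 ≠ 0 := by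
      have := Real.add_one_lt_exp ht.ne'
      linarith
    field_simp
  rw [h2] at h
  have h' := Complex.hasSum_ofReal.2 h
  rw [← Equiv.pnatEquivNat.hasSum_iff] at h'
  convert h' using 2
  · rename_i m
    simp only [Function.comp, Equiv.pnatEquivNat_apply, one_mul, ← pow_succ']
    rw [PNat.natPred_add_one]
  · simp [bose]

/-! ### Tail integrals and Mellin transforms of series of exponentials. -/

namespace HasPowSeries

variable {ι : Type*} {a : ι → ℝ} {p : ι → ℕ} {F h : ℝ → ℂ}

/-- Termwise integration, since ∫_t^∞ e^{-pu} du = e^{-pt}/p. Nonnegativity and p ≥ 1 dominate the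
new series by the old one. -/
theorem tailInt [Countable ι] (hF : HasExpSeries a p F) (hp : ∀ i, 0 < p i) :
    HasExpSeries (fun i => a i / p i) p (tailInt F) := by
  refine ⟨fun i => div_nonneg (hF.nonneg i) (Nat.cast_nonneg _), fun t ht => ?_⟩
  have hneg : ∀ i, -(p i : ℝ) < 0 := fun i => neg_lt_zero.2 (Nat.cast_pos.2 (hp i))
  have hi : ∀ i, IntegrableOn (fun u => a i * Real.exp (-u) ^ p i) (Ioi t) := fun i => by
    simp only [exp_neg_pow]
    exact (integrableOn_exp_mul_Ioi (hneg i) t).const_mul (a i)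
  have hv : ∀ i, ∫ u in Ioi t, a i * Real.exp (-u) ^ p i = a i / p i * Real.exp (-t) ^ p i := by
    intro i
    have hp0 : (p i : ℝ) ≠ 0 := Nat.cast_ne_zero.2 (hp i).ne'
    simp only [exp_neg_pow]
    rw [integral_const_mul, integral_exp_mul_Ioi (hneg i)]
    field_simp
  have hs : Summable fun i => a i / p i * Real.exp (-t) ^ p i := by
    refine Summable.of_nonneg_of_le (fun i => ?_) (fun i => ?_) (hF.summable ht)
    · exact mul_nonneg (div_nonneg (hF.nonneg i) (Nat.cast_nonneg _)) (by positivity)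
    · gcongr
      exact div_le_self (hF.nonneg i) (by exact_mod_cast hp i)
  have key := hasSum_integral_of_summable_integral_norm (μ := volume.restrict (Ioi t))
    (F := fun i u => ((a i * Real.exp (-u) ^ p i : ℝ) : ℂ)) (fun i => (hi i).ofReal) (by
      refine hs.congr fun i => ?_
      rw [← hv i]
      refine integral_congr_ae (Eventually.of_forall fun u => ?_)
      simp only
      rw [Complex.norm_real, Real.norm_of_nonneg (mul_nonneg (hF.nonneg i) (by positivity))])
  have hint : _root_.tailInt F t =
      ∫ u in Ioi t, ∑' i, ((a i * Real.exp (-u) ^ p i : ℝ) : ℂ) :=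
    setIntegral_congr_fun measurableSet_Ioi fun u hu =>
      (hF.hasSum u (lt_trans ht hu)).tsum_eq.symm
  rw [hint]
  refine key.congr_apply fun i => ?_
  rw [integral_complex_ofReal, hv]

theorem iterate_tailInt [Countable ι] (hF : HasExpSeries a p F) (hp : ∀ i, 0 < p i) (n : ℕ) :
    HasExpSeries (fun i => a i / (p i : ℝ) ^ n) p (_root_.tailInt^[n] F) := by
  induction n with
  | zero => simpa using hF
  | succ n ih =>
    rw [Function.iterate_succ_apply']
    have := ih.tailInt hp
    simpa only [div_div, ← pow_succ] using this

/-- By positivity, Γ(Re s) times any finite partial sum is at most ∫ |t^{s-1} F(t)| dt. Thus no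
multiple series has to be estimated directly. -/
theorem summable_of_mellinConvergent (hF : HasExpSeries a p F) (hp : ∀ i, 0 < p i) {s : ℂ}
    (hs : 0 < s.re) (hm : MellinConvergent F s) : Summable fun i => a i / (p i : ℝ) ^ s.re := by
  have hΓ : 0 < Real.Gamma s.re := Real.Gamma_pos_of_pos hs
  have hv : ∀ i, ∫ t in Ioi (0 : ℝ), a i * (t ^ (s.re - 1) * Real.exp (-((p i : ℝ) * t))) =
      a i / (p i : ℝ) ^ s.re * Real.Gamma s.re := by
    intro i
    have hp0 : (0 : ℝ) < p i := Nat.cast_pos.2 (hp i)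
    rw [integral_const_mul, Real.integral_rpow_mul_exp_neg_mul_Ioi hs hp0,
      Real.div_rpow zero_le_one hp0.le, Real.one_rpow]
    ring
  have hi : ∀ i, IntegrableOn
      (fun t => a i * (t ^ (s.re - 1) * Real.exp (-((p i : ℝ) * t)))) (Ioi 0) := by
    intro i
    have hp0 : (0 : ℝ) < p i := Nat.cast_pos.2 (hp i)
    have := integrableOn_rpow_mul_exp_neg_mul_rpow (p := 1) (s := s.re - 1) (by linarith) one_pos
      hp0
    refine Integrable.const_mul (this.congr_fun (fun t _ => ?_) measurableSet_Ioi) (a i)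
    simp [neg_mul]
  refine summable_of_sum_le (c := (∫ t in Ioi (0 : ℝ), ‖(t : ℂ) ^ (s - 1) • F t‖) /
    Real.Gamma s.re) (fun i => div_nonneg (hF.nonneg i) (by positivity)) fun S => ?_
  rw [le_div_iff₀ hΓ, Finset.sum_mul]
  simp only [← hv]
  rw [← integral_finsetSum S fun i _ => hi i]
  refine setIntegral_mono_on (integrable_finsetSum S fun i _ => hi i) hm.norm measurableSet_Ioi ?_
  intro t ht
  have ht : 0 < t := ht
  have hreal : F t = ((∑' i, a i * Real.exp (-t) ^ p i : ℝ) : ℂ) := by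
    rw [Complex.ofReal_tsum]
    exact (hF.hasSum t ht).tsum_eq.symm
  have hnn : ∀ i, 0 ≤ a i * Real.exp (-t) ^ p i := fun i =>
    mul_nonneg (hF.nonneg i) (by positivity)
  rw [norm_smul, Complex.norm_cpow_eq_rpow_re_of_pos ht, hreal, Complex.norm_real,
    Real.norm_of_nonneg (tsum_nonneg hnn)]
  calc ∑ i ∈ S, a i * (t ^ (s.re - 1) * Real.exp (-((p i : ℝ) * t)))
      = t ^ (s.re - 1) * ∑ i ∈ S, a i * Real.exp (-t) ^ p i := by
        rw [Finset.mul_sum]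
        refine Finset.sum_congr rfl fun i _ => ?_
        rw [exp_neg_pow, neg_mul]
        ring
    _ ≤ t ^ (s - 1).re * ∑' i, a i * Real.exp (-t) ^ p i := by
        rw [Complex.sub_re, Complex.one_re]
        exact mul_le_mul_of_nonneg_left ((hF.summable ht).sum_le_tsum S fun i _ => hnn i)
          (Real.rpow_nonneg ht.le _)

theorem hasSum_mellin [Countable ι] (hF : HasExpSeries a p F) (hp : ∀ i, 0 < p i) {s : ℂ}
    (hs : 0 < s.re) (hm : MellinConvergent F s) :
    HasSum (fun i => (a i : ℂ) / (p i : ℂ) ^ s) (1 / Complex.Gamma s * mellin F s) := by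
  have hsum := hF.summable_of_mellinConvergent hp hs hm
  have h := _root_.hasSum_mellin (a := fun i => (a i : ℂ)) (p := fun i => (p i : ℝ)) (F := F)
    (s := s) (fun i => Or.inr (Nat.cast_pos.2 (hp i))) hs
    (fun t ht => by
      convert hF.hasSum t ht using 2 with i
      rw [exp_neg_pow]
      push_cast
      rfl)
    (by
      refine hsum.congr fun i => ?_
      rw [Complex.norm_real, Real.norm_of_nonneg (hF.nonneg i)])
  have hΓ : Complex.Gamma s ≠ 0 := Complex.Gamma_ne_zero_of_re_pos hs
  refine (h.mul_left (1 / Complex.Gamma s)).congr_apply fun i => ?_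
  rw [Complex.ofReal_natCast]
  field_simp

/-- Multiplication by ∑ e^{-mt} adds one free positive variable to the exponent: a gap in the
Euler–Zagier sum, a p_u in the Miyagawa sum. -/
theorem mul_bose (hF : HasExpSeries a p h) :
    HasExpSeries (fun x : ι × ℕ+ => a x.1) (fun x => p x.1 + x.2) (fun t => bose t * h t) := by
  have := (hF.mul hasExpSeries_bose).congr (G := fun t => bose t * h t) fun t _ => mul_comm _ _
  simpa only [mul_one] using this

/-! ### The Miyagawa series as a Mellin transform -/

/-- Each block of b_u + 1 tail integrals divides by that power of the current exponent, and the next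
factor `bose` adds a p_u to it. -/
theorem chainInt [Countable ι] (hF : HasExpSeries a p fun t => bose t * h t) (hp : ∀ i, 0 < p i)
    {k : ℕ} (b : Fin (k + 1) → ℕ) :
    HasExpSeries (fun x : ι × (Fin k → ℕ+) => a x.1 /
        ∏ u : Fin k, ((p x.1 : ℝ) + ∑ w : Fin k with w < u, ((x.2 w : ℕ) : ℝ)) ^
          (b u.castSucc + 1))
      (fun x => p x.1 + ∑ w, (x.2 w : ℕ)) (fun t => bose t * chainInt k b h t) := by
  induction k generalizing ι h with
  | zero =>
    exact hF.reindex (Equiv.prodUnique ι (Fin 0 → ℕ+)) (by simp) (by simp)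
  | succ k ih =>
    have h1 := ih ((hF.iterate_tailInt hp (b 0 + 1)).mul_bose)
      (fun x => Nat.add_pos_left (hp x.1) _) (Fin.tail b)
    let e : ι × (Fin (k + 1) → ℕ+) ≃ (ι × ℕ+) × (Fin k → ℕ+) :=
      ((Equiv.refl ι).prodCongr (Fin.consEquiv fun _ => ℕ+).symm).trans
        (Equiv.prodAssoc ι ℕ+ (Fin k → ℕ+)).symm
    have he : ∀ x, e x = ((x.1, x.2 0), Fin.tail x.2) := fun x => rfl
    refine h1.reindex e (fun x => ?_) fun x => ?_
    · simp only [he]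
      rw [Fin.prod_univ_succ, div_div]
      congr 2
      · simp
      · refine Finset.prod_congr rfl fun u _ => ?_
        congr 1
        rw [Finset.sum_filter, Finset.sum_filter, Fin.sum_univ_succ]
        simp [Fin.tail, add_assoc]
    · simp only [he]
      rw [Fin.sum_univ_succ, add_assoc]
      rfl

end HasPowSeries

/-! ### The Euler–Zagier series as a Mellin transform -/

theorem strictMono_snoc_add {n : ℕ} {m : Fin (n + 1) → ℕ+} (hm : StrictMono m) (q : ℕ+) :
    StrictMono (Fin.snoc m (m (Fin.last n) + q) : Fin (n + 2) → ℕ+) := by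
  rw [Fin.strictMono_iff_lt_succ]
  intro i
  rw [Fin.snoc_castSucc]
  refine Fin.lastCases ?_ (fun i => ?_) i
  · rw [Fin.succ_last, Fin.snoc_last]
    exact PNat.lt_add_right _ _
  · rw [Fin.succ_castSucc, Fin.snoc_castSucc]
    exact hm i.castSucc_lt_succ

/-- A strictly increasing tuple is determined by its initial part and the last gap. -/
def strictMonoSnocEquiv (n : ℕ) : {m : Fin (n + 2) → ℕ+ // StrictMono m} ≃
    {m : Fin (n + 1) → ℕ+ // StrictMono m} × ℕ+ where
  toFun m := (⟨Fin.init m.1, fun _ _ h => m.2 (Fin.castSucc_lt_castSucc_iff.2 h)⟩,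
    m.1 (Fin.last (n + 1)) - m.1 (Fin.last n).castSucc)
  invFun x := ⟨Fin.snoc x.1.1 (x.1.1 (Fin.last n) + x.2), strictMono_snoc_add x.1.2 x.2⟩
  left_inv m := by
    apply Subtype.ext
    have h : m.1 (Fin.last n).castSucc < m.1 (Fin.last (n + 1)) := m.2 (Fin.castSucc_lt_last _)
    simp only [Fin.init, PNat.add_sub_of_lt h]
    exact Fin.snoc_init_self m.1
  right_inv x := by
    refine Prod.ext (Subtype.ext ?_) ?_
    · exact Fin.init_snoc (α := fun _ : Fin (n + 2) => ℕ+) _ _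
    simp only [Fin.snoc_last, Fin.snoc_castSucc]
    rw [add_comm, PNat.add_sub]

/-- A tail integral divides by the largest index, and the next factor `bose` adds the gap to a new
largest one. -/
theorem hasExpSeries_ez (n : ℕ) :
    HasExpSeries (fun m : {m : Fin (n + 1) → ℕ+ // StrictMono m} =>
        ∏ i : Fin n, (1 / ((m.1 i.castSucc : ℕ) : ℝ)))
      (fun m => (m.1 (Fin.last n) : ℕ)) (fun t => bose t * boseInt^[n] (fun _ => 1) t) := by
  induction n with
  | zero =>
    let e : {m : Fin 1 → ℕ+ // StrictMono m} ≃ ℕ+ :=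
      { toFun := fun m => m.1 0
        invFun := fun q => ⟨fun _ => q, Subsingleton.strictMono _⟩
        left_inv := fun m => Subtype.ext (funext fun i => by rw [Subsingleton.elim i 0])
        right_inv := fun q => rfl }
    refine (hasExpSeries_bose.reindex e (fun m => by simp) fun m => rfl).congr fun t _ => by simp
  | succ n ih =>
    have h := (ih.tailInt fun m => PNat.pos _).mul_bose
    rw [Function.iterate_succ_apply']
    refine h.reindex (strictMonoSnocEquiv n) (fun m => ?_) fun m => ?_
    · rw [Fin.prod_univ_castSucc]
      simp [strictMonoSnocEquiv, Fin.init, div_eq_mul_inv]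
    · have h : m.1 (Fin.last n).castSucc < m.1 (Fin.last (n + 1)) := m.2 (Fin.castSucc_lt_last _)
      simp only [strictMonoSnocEquiv, Equiv.coe_fn_mk, Fin.init]
      rw [← PNat.add_coe, PNat.add_sub_of_lt h]

theorem tame_iterate_boseInt_one (n : ℕ) : Tame (boseInt^[n] fun _ => 1) :=
  (Tame.const 1).iterate_boseInt n

theorem hasSum_ezTerm (n : ℕ) {s : ℂ} (hs : 1 < s.re) :
    HasSum (ezTerm (onesThen n s))
      (1 / Complex.Gamma s * mellin (fun t => bose t * boseInt^[n] (fun _ => 1) t) s) := by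
  refine ((hasExpSeries_ez n).hasSum_mellin (fun m => PNat.pos _) (by linarith)
    ((tame_iterate_boseInt_one n).mellinConvergent_bose_mul hs)).congr_apply fun m => ?_
  simp [ezTerm, onesThen, Fin.prod_univ_castSucc, div_eq_mul_inv, mul_comm]

/-! ### The Miyagawa series as a Mellin transform -/

theorem rapid_iterate_tailInt_bose (n : ℕ) : Rapid (tailInt^[n + 1] bose) := by
  have h : Rapid (tailInt bose) := by
    simpa [boseInt] using (Tame.const 1).boseInt
  exact h.iterate_tailInt n

/-- The function `Li₂(e^{-t})^a * Li₁(e^{-t})^c`. -/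
def polylogMul (a c : ℕ) (t : ℝ) : ℂ :=
  tailInt^[2] bose t ^ a * tailInt bose t ^ c

theorem tame_polylogMul (a c : ℕ) : Tame (polylogMul a c) :=
  ((rapid_iterate_tailInt_bose 1).tame.pow a).mul ((rapid_iterate_tailInt_bose 0).tame.pow c)

theorem prod_fin_ite {M : Type*} [CommMonoid M] {l a : ℕ} (ha : a ≤ l) (x y : M) :
    (∏ v : Fin l, if (v : ℕ) < a then x else y) = x ^ a * y ^ (l - a) := by
  rw [Fin.prod_univ_eq_prod_range (fun v => if v < a then x else y) l, Finset.prod_ite,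
    Finset.prod_const, Finset.prod_const]
  have h1 : (Finset.range l).filter (fun v => v < a) = Finset.range a := by
    ext v; simp; omega
  have h2 := Finset.card_filter_add_card_filter_not (s := Finset.range l) (fun v => v < a)
  rw [h1, Finset.card_range, Finset.card_range] at h2
  rw [h1, Finset.card_range]
  congr 2
  omega

/-- The index `(0, {2}^a, {1}^{l-a})` with natural number entries. -/
def zeroTwosOnesNat (l a : ℕ) : Fin (l + 1) → ℕ :=
  Fin.cons 0 fun v : Fin l => if (v : ℕ) < a then 2 else 1

theorem zeroTwosOnes_eq (l a : ℕ) (v : Fin (l + 1)) :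
    zeroTwosOnes l a v = (zeroTwosOnesNat l a v : ℂ) := by
  refine Fin.cases ?_ (fun v => ?_) v
  · simp [zeroTwosOnes, zeroTwosOnesNat]
  · simp [zeroTwosOnes, zeroTwosOnesNat]

/-- The variable m₀ of exponent 0 comes from the bare factor `bose`, those of exponents 1 and 2 from
its first and second tail integrals. -/
theorem hasExpSeries_zeroTwosOnes {l a : ℕ} (ha : a ≤ l) :
    HasExpSeries (fun m : Fin (l + 1) → ℕ+ =>
        ∏ v, (1 / ((m v : ℕ) : ℝ) ^ zeroTwosOnesNat l a v))
      (fun m => ∑ v, (m v : ℕ)) (fun t => bose t * polylogMul a (l - a) t) := by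
  have h := HasPowSeries.pi (fun v : Fin (l + 1) =>
    hasExpSeries_bose.iterate_tailInt (fun m => PNat.pos m) (zeroTwosOnesNat l a v))
  refine h.congr fun t _ => ?_
  simp only [Fin.prod_univ_succ, zeroTwosOnesNat, Fin.cons_zero, Fin.cons_succ, polylogMul,
    Function.iterate_zero, id_eq]
  rw [← prod_fin_ite ha]
  congr 1
  refine Finset.prod_congr rfl fun v _ => ?_
  split_ifs <;> rfl

theorem hasSum_miyagawaTerm {l a k : ℕ} (ha : a ≤ l) (b : Fin (k + 1) → ℕ) {s : ℂ}
    (hs : 1 < s.re) :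
    HasSum (miyagawaTerm (zeroTwosOnes l a) (shiftedIndex b s))
      (1 / Complex.Gamma (s + b (Fin.last k)) *
        mellin (fun t => bose t * chainInt k b (polylogMul a (l - a)) t)
          (s + b (Fin.last k))) := by
  have hp : ∀ m : Fin (l + 1) → ℕ+, 0 < ∑ v, (m v : ℕ) := fun m =>
    Finset.sum_pos (fun v _ => PNat.pos _) Finset.univ_nonempty
  have hs' : 1 < (s + b (Fin.last k)).re := by
    rw [Complex.add_re, Complex.natCast_re]
    have : (0 : ℝ) ≤ b (Fin.last k) := Nat.cast_nonneg _
    linarith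
  refine (((hasExpSeries_zeroTwosOnes ha).chainInt hp b).hasSum_mellin
    (fun x => Nat.add_pos_left (hp x.1) _) (by linarith)
    (((tame_polylogMul a (l - a)).chainInt b).mellinConvergent_bose_mul hs')).congr_apply
    fun x => ?_
  simp only [miyagawaTerm, zeroTwosOnes_eq, Complex.cpow_natCast]
  rw [Fin.prod_univ_castSucc (n := k)]
  have h1 : ∀ u : Fin k, shiftedIndex b s u.castSucc = ((b u.castSucc + 1 : ℕ) : ℂ) := fun u => by
    simp [shiftedIndex]
  have h2 : shiftedIndex b s (Fin.last k) = s + b (Fin.last k) := by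
    simp [shiftedIndex, add_comm]
  simp only [h1, h2, Complex.cpow_natCast, Fin.castSucc_lt_castSucc_iff, Fin.castSucc_lt_last,
    Finset.filter_true]
  push_cast
  simp only [one_div, Finset.prod_inv_distrib]
  field_simp

/-! ### The polylogarithms `Li_{{2}^j; k}(1 - e^{-t})` -/

/-- The coefficient `1 / (m₁² ⋯ m_j² (m₁ + ⋯ + m_j)^k)`. -/
def mtCoeff (j k : ℕ) (m : Fin j → ℕ+) : ℝ :=
  (∏ v, (1 / ((m v : ℕ) : ℝ) ^ 2)) / ((∑ v, (m v : ℕ) : ℕ) : ℝ) ^ k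

theorem mtCoeff_nonneg (j k : ℕ) (m : Fin j → ℕ+) : 0 ≤ mtCoeff j k m := by
  unfold mtCoeff
  positivity

theorem summable_one_div_pnat_sq : Summable fun m : ℕ+ => 1 / ((m : ℕ) : ℝ) ^ 2 :=
  (Real.summable_one_div_nat_pow.2 one_lt_two).comp_injective PNat.coe_injective

theorem mtCoeff_succ (j k : ℕ) (m : Fin j → ℕ+) :
    mtCoeff j (k + 1) m = mtCoeff j k m / ((∑ v, (m v : ℕ) : ℕ) : ℝ) := by
  rw [mtCoeff, mtCoeff, pow_succ, div_div]

theorem summable_mtCoeff_zero (j : ℕ) : Summable (mtCoeff j 0) := by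
  -- With base 1 a power series is a plain sum, so `HasPowSeries.pi` yields summability of products.
  have h1 : HasPowSeries (fun _ => 1) (fun m : ℕ+ => 1 / ((m : ℕ) : ℝ) ^ 2) (fun m => (m : ℕ))
      (fun _ => ((∑' m : ℕ+, 1 / ((m : ℕ) : ℝ) ^ 2 : ℝ) : ℂ)) :=
    ⟨fun m => by positivity, fun t _ => by
      simpa using Complex.hasSum_ofReal.2 summable_one_div_pnat_sq.hasSum⟩
  refine ((HasPowSeries.pi fun _ : Fin j => h1).summable one_pos).congr fun m => ?_
  simp [mtCoeff]

theorem summable_mtCoeff {j : ℕ} (hj : 1 ≤ j) (k : ℕ) : Summable (mtCoeff j k) := by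
  refine Summable.of_nonneg_of_le (mtCoeff_nonneg j k) (fun m => ?_) (summable_mtCoeff_zero j)
  have : 1 ≤ ∑ v, (m v : ℕ) := by
    have : Nonempty (Fin j) := ⟨⟨0, hj⟩⟩
    exact Finset.sum_pos (fun v _ => PNat.pos _) Finset.univ_nonempty
  unfold mtCoeff
  rw [pow_zero, div_one]
  refine div_le_self (by positivity) (one_le_pow₀ ?_)
  exact_mod_cast this

theorem one_sub_exp_neg_pos {t : ℝ} (ht : 0 < t) : 0 < 1 - Real.exp (-t) := by
  have : Real.exp (-t) < 1 := by simpa using ht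
  linarith

theorem hasDerivAt_one_sub_exp_neg_pow {n : ℕ} (hn : 0 < n) {t : ℝ} (ht : 0 < t) :
    HasDerivAt (fun u => (1 - Real.exp (-u)) ^ n / n)
      (1 / (Real.exp t - 1) * (1 - Real.exp (-t)) ^ n) t := by
  have h := (((((hasDerivAt_id t).neg).exp).const_sub 1).fun_pow n).div_const (n : ℝ)
  refine h.congr_deriv ?_
  obtain ⟨n, rfl⟩ := Nat.exists_eq_add_of_lt hn
  have hn0 : ((0 + n + 1 : ℕ) : ℝ) ≠ 0 := by positivity
  have h3 : Real.exp t - 1 ≠ 0 := by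
    have := Real.add_one_lt_exp ht.ne'
    linarith
  simp only [id, add_tsub_cancel_right, pow_succ, Real.exp_neg, Pi.neg_apply]
  have : Real.exp t ≠ 0 := (Real.exp_pos t).ne'
  field_simp

/-- With r = 1 - e^{-t}, r^p/p is an antiderivative of r^p/(e^t - 1) and r → 1 at infinity, so T r^p
= (1 - r^p)/p. Summability of a/p allows the two parts to be summed separately. -/
theorem HasPowSeries.boseInt_one_sub_exp {ι : Type*} [Countable ι] {a : ι → ℝ} {p : ι → ℕ}
    {F : ℝ → ℂ} (hF : HasPowSeries (fun t => 1 - Real.exp (-t)) a p F) (hp : ∀ i, 0 < p i)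
    (hs : Summable fun i => a i / p i) :
    HasPowSeries (fun t => 1 - Real.exp (-t)) (fun i => a i / p i) p
      (fun t => ((∑' i, a i / p i : ℝ) : ℂ) - boseInt F t) := by
  have hnn : ∀ i, 0 ≤ a i / p i := fun i => div_nonneg (hF.nonneg i) (Nat.cast_nonneg _)
  refine ⟨hnn, fun t ht => ?_⟩
  set f : ι → ℝ → ℝ := fun i u => a i * (1 / (Real.exp u - 1) * (1 - Real.exp (-u)) ^ p i) with hf
  have hpos : ∀ i, ∀ u ∈ Set.Ioi t, 0 ≤ f i u := by
    intro i u hu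
    have hu0 : 0 < u := lt_trans ht hu
    have h1 := one_sub_exp_neg_pos hu0
    have h2 : 0 < Real.exp u - 1 := by linarith [Real.add_one_lt_exp hu0.ne']
    have := hF.nonneg i
    positivity
  have hd : ∀ i, ∀ u ∈ Set.Ici t, HasDerivAt
      (fun u => a i * ((1 - Real.exp (-u)) ^ p i / p i)) (f i u) u := fun i u hu =>
    (hasDerivAt_one_sub_exp_neg_pow (hp i) (lt_of_lt_of_le ht hu)).const_mul (a i)
  have hlim : ∀ i, Tendsto (fun u : ℝ => a i * ((1 - Real.exp (-u)) ^ p i / p i)) atTop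
      (𝓝 (a i / p i)) := by
    intro i
    have h0 : Tendsto (fun u : ℝ => Real.exp (-u)) atTop (𝓝 0) := Real.tendsto_exp_neg_atTop_nhds_zero
    have := ((((tendsto_const_nhds (x := (1 : ℝ))).sub h0).pow (p i)).div_const
      (p i : ℝ)).const_mul (a i)
    simpa [div_eq_mul_inv] using this
  have hv : ∀ i, ∫ u in Ioi t, f i u = a i / p i - a i / p i * (1 - Real.exp (-t)) ^ p i := by
    intro i
    rw [integral_Ioi_of_hasDerivAt_of_nonneg' (hd i) (hpos i) (hlim i)]
    ring
  have hi : ∀ i, IntegrableOn (f i) (Ioi t) := fun i =>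
    integrableOn_Ioi_deriv_of_nonneg' (hd i) (hpos i) (hlim i)
  have hs' : Summable fun i => a i / p i * (1 - Real.exp (-t)) ^ p i := by
    refine Summable.of_nonneg_of_le (fun i => ?_) (fun i => ?_) hs
    · exact mul_nonneg (hnn i) (pow_nonneg (one_sub_exp_neg_pos ht).le _)
    · refine mul_le_of_le_one_right (hnn i) (pow_le_one₀ (one_sub_exp_neg_pos ht).le ?_)
      linarith [Real.exp_pos (-t)]
  have key := hasSum_integral_of_summable_integral_norm (μ := volume.restrict (Ioi t))
    (F := fun i u => ((f i u : ℝ) : ℂ)) (fun i => (hi i).ofReal) (by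
      refine (hs.sub hs').congr fun i => ?_
      rw [← hv i]
      refine setIntegral_congr_fun measurableSet_Ioi fun u hu => ?_
      rw [Complex.norm_real, Real.norm_of_nonneg (hpos i u hu)])
  have hint : boseInt F t = ∫ u in Ioi t, ∑' i, ((f i u : ℝ) : ℂ) := by
    refine setIntegral_congr_fun measurableSet_Ioi fun u hu => ?_
    have h1 := ((hF.hasSum u (lt_trans ht hu)).mul_left (bose u)).tsum_eq
    rw [← h1]
    refine tsum_congr fun i => ?_
    simp only [hf, bose]
    push_cast
    ring
  rw [← hint] at key
  refine ((Complex.hasSum_ofReal.2 hs.hasSum).sub key).congr_apply fun i => ?_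
  rw [integral_complex_ofReal, hv]
  push_cast
  ring

/-- This is the logarithm series, as t = -log(1 - r) with r = 1 - e^{-t}. -/
theorem hasPowSeries_ofReal :
    HasPowSeries (fun t => 1 - Real.exp (-t)) (fun m : ℕ+ => 1 / ((m : ℕ) : ℝ))
      (fun m => (m : ℕ)) (fun t => (t : ℂ)) := by
  refine ⟨fun m => by positivity, fun t ht => ?_⟩
  have h1 := one_sub_exp_neg_pos ht
  have h := Real.hasSum_pow_div_log_of_abs_lt_one (x := 1 - Real.exp (-t))
    (by rw [abs_of_pos h1]; linarith [Real.exp_pos (-t)])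
  rw [sub_sub_cancel, Real.log_exp, neg_neg] at h
  have h' := Complex.hasSum_ofReal.2 h
  rw [← Equiv.pnatEquivNat.hasSum_iff] at h'
  refine h'.congr_apply fun m => ?_
  have hm : ((m.natPred : ℝ) + 1) = ((m : ℕ) : ℝ) := by exact_mod_cast PNat.natPred_add_one m
  simp only [Function.comp, Equiv.pnatEquivNat_apply, PNat.natPred_add_one, hm]
  congr 1
  ring

theorem riemannZeta_two_eq_tsum_pnat :
    riemannZeta 2 = ((∑' m : ℕ+, 1 / ((m : ℕ) : ℝ) ^ 2 : ℝ) : ℂ) := by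
  have h := zeta_nat_eq_tsum_of_gt_one one_lt_two
  rw [Nat.cast_ofNat] at h
  rw [h, Complex.ofReal_tsum]
  have := tsum_pnat_eq_tsum_succ (f := fun n : ℕ => 1 / (n : ℂ) ^ 2)
  rw [tsum_eq_zero_add']
  · simp at this ⊢
    rw [this]
  · have := Complex.summable_ofReal.2
      ((summable_nat_add_iff 1).2 (Real.summable_one_div_nat_pow.2 one_lt_two))
    simpa using this

/-- The function `Li₂(1 - e^{-t})`. -/
def dilogCompl (t : ℝ) : ℂ :=
  riemannZeta 2 - boseInt (fun t => (t : ℂ)) t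

theorem hasPowSeries_dilogCompl :
    HasPowSeries (fun t => 1 - Real.exp (-t)) (fun m : ℕ+ => 1 / ((m : ℕ) : ℝ) ^ 2)
      (fun m => (m : ℕ)) dilogCompl := by
  have hsq : ∀ m : ℕ+, 1 / ((m : ℕ) : ℝ) / ((m : ℕ) : ℝ) = 1 / ((m : ℕ) : ℝ) ^ 2 := fun m => by
    rw [div_div, sq]
  have h := hasPowSeries_ofReal.boseInt_one_sub_exp (fun m => PNat.pos m)
    (summable_one_div_pnat_sq.congr fun m => (hsq m).symm)
  simp only [hsq, ← riemannZeta_two_eq_tsum_pnat] at h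
  exact h

theorem tame_dilogCompl : Tame dilogCompl := by
  have h := (Tame.const (riemannZeta 2)).add ((Tame.const (-1)).mul Tame.ofReal.boseInt.tame)
  exact h.congr fun t _ => by simp only [dilogCompl]; ring

/-- The function `Li_{{2}^j; k}(1 - e^{-t})`. -/
def mtPolylog (j : ℕ) : ℕ → ℝ → ℂ
  | 0 => fun t => dilogCompl t ^ j
  | k + 1 => fun t => ((∑' m, mtCoeff j (k + 1) m : ℝ) : ℂ) - boseInt (mtPolylog j k) t

theorem tame_mtPolylog (j k : ℕ) : Tame (mtPolylog j k) := by
  induction k with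
  | zero => exact tame_dilogCompl.pow j
  | succ k ih =>
    have h := (Tame.const ((∑' m, mtCoeff j (k + 1) m : ℝ) : ℂ)).add
      ((Tame.const (-1)).mul ih.boseInt.tame)
    exact h.congr fun t _ => by simp only [mtPolylog]; ring

theorem hasPowSeries_mtPolylog {j : ℕ} (hj : 1 ≤ j) (k : ℕ) :
    HasPowSeries (fun t => 1 - Real.exp (-t)) (mtCoeff j k) (fun m => ∑ v, (m v : ℕ))
      (mtPolylog j k) := by
  induction k with
  | zero =>
    have h := HasPowSeries.pi fun _ : Fin j => hasPowSeries_dilogCompl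
    refine (h.reindex (Equiv.refl _) (fun m => by simp [mtCoeff]) fun m => rfl).congr
      fun t _ => ?_
    simp [mtPolylog]
  | succ k ih =>
    have : Nonempty (Fin j) := ⟨⟨0, hj⟩⟩
    have h := ih.boseInt_one_sub_exp
      (fun m => Finset.sum_pos (fun v _ => PNat.pos _) Finset.univ_nonempty)
      ((summable_mtCoeff hj (k + 1)).congr fun m => mtCoeff_succ j k m)
    simp only [← mtCoeff_succ] at h
    exact h

theorem mtLi_one_sub_exp {j : ℕ} (hj : 1 ≤ j) (k : ℕ) {t : ℝ} (ht : 0 < t) :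
    mtLi (fun _ : Fin j => 2) k (1 - Complex.exp (-t)) = mtPolylog j k t := by
  rw [← ((hasPowSeries_mtPolylog hj k).hasSum t ht).tsum_eq, mtLi]
  refine tsum_congr fun m => ?_
  simp only [mtCoeff]
  push_cast
  simp only [one_div, Finset.prod_inv_distrib]
  field_simp

theorem mtTerm_eq (j i : ℕ) (m : Fin j → ℕ+) :
    mtTerm (fun _ : Fin j => (2 : ℂ)) (i : ℂ) m = ((mtCoeff j i m : ℝ) : ℂ) := by
  simp only [mtTerm, mtCoeff, Complex.cpow_natCast, Complex.cpow_ofNat]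
  push_cast
  simp only [one_div, Finset.prod_inv_distrib]
  field_simp

theorem mtZeta_eq (j i : ℕ) :
    mtZeta (fun _ : Fin j => (2 : ℂ)) (i : ℂ) = ((∑' m, mtCoeff j i m : ℝ) : ℂ) := by
  rw [mtZeta, Complex.ofReal_tsum]
  exact tsum_congr (mtTerm_eq j i)

/-! ### The generalized Ito zeta function -/

/-- All exponents m₁ + ⋯ + m_j are at least j, and 0 < r ≤ min(1, t). This vanishing to order j at 0
gives ξ_MT its half-plane Re s > 1 - j. -/
theorem norm_mtPolylog_le {j : ℕ} (hj : 1 ≤ j) (k : ℕ) {t : ℝ} (ht : 0 < t) :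
    ‖mtPolylog j k t‖ ≤ (∑' m, mtCoeff j k m) * t ^ j := by
  have h := hasPowSeries_mtPolylog hj k
  have hr0 := one_sub_exp_neg_pos ht
  have hr1 : 1 - Real.exp (-t) ≤ 1 := by linarith [Real.exp_pos (-t)]
  have hrt : 1 - Real.exp (-t) ≤ t := by linarith [Real.add_one_le_exp (-t)]
  rw [← (h.hasSum t ht).tsum_eq, ← Complex.ofReal_tsum, Complex.norm_real, Real.norm_of_nonneg
    (tsum_nonneg fun m => mul_nonneg (mtCoeff_nonneg j k m) (pow_nonneg hr0.le _)),
    ← tsum_mul_right]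
  refine (h.summable ht).tsum_le_tsum (fun m => ?_) ((summable_mtCoeff hj k).mul_right _)
  refine mul_le_mul_of_nonneg_left ?_ (mtCoeff_nonneg j k m)
  have hjm : j ≤ ∑ v, (m v : ℕ) := by
    calc j = ∑ _v : Fin j, 1 := by simp
      _ ≤ _ := Finset.sum_le_sum fun v _ => (m v).pos
  exact (pow_le_pow_of_le_one hr0.le hr1 hjm).trans (pow_le_pow_left₀ hr0.le hrt j)

theorem isBigO_bose_mul_mtPolylog {j : ℕ} (hj : 1 ≤ j) (k : ℕ) :
    (fun t => bose t * mtPolylog j k t) =O[𝓝[>] 0] fun t : ℝ => t ^ (-(1 - (j : ℝ))) := by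
  refine Asymptotics.IsBigO.of_bound (∑' m, mtCoeff j k m) ?_
  filter_upwards [self_mem_nhdsWithin] with t ht
  have ht : 0 < t := ht
  have hb : ‖bose t‖ ≤ t⁻¹ := by
    have h1 : t ≤ Real.exp t - 1 := by linarith [Real.add_one_le_exp t]
    have : bose t = (((Real.exp t - 1)⁻¹ : ℝ) : ℂ) := by simp [bose]
    rw [this, Complex.norm_real, Real.norm_of_nonneg (inv_nonneg.2 (by linarith))]
    exact inv_anti₀ ht h1
  rw [norm_mul, Real.norm_of_nonneg (Real.rpow_nonneg ht.le _)]
  refine (mul_le_mul hb (norm_mtPolylog_le hj k ht) (norm_nonneg _) (by positivity)).trans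
    (le_of_eq ?_)
  rw [neg_sub, Real.rpow_sub_one ht.ne', Real.rpow_natCast]
  ring

theorem itoIntegrand_eq {j : ℕ} (hj : 1 ≤ j) (k : ℕ) (s : ℂ) :
    EqOn (fun t : ℝ => (t : ℂ) ^ (s - 1) • (bose t * mtPolylog j k t))
      (itoIntegrand (fun _ : Fin j => 2) k s) (Ioi 0) := by
  intro t ht
  simp only [itoIntegrand, smul_eq_mul, bose]
  rw [mtLi_one_sub_exp hj k ht]
  ring

theorem integrableOn_itoIntegrand {j : ℕ} (hj : 1 ≤ j) (k : ℕ) {s : ℂ}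
    (hs : 1 - (j : ℝ) < s.re) :
    IntegrableOn (itoIntegrand (fun _ : Fin j => 2) k s) (Ioi 0) := by
  have hd := (tame_mtPolylog j k).expDecay_bose_mul
  obtain ⟨c, hc, hO⟩ := hd.decay
  have h : MellinConvergent (fun t => bose t * mtPolylog j k t) s :=
    mellinConvergent_of_isBigO_rpow_exp hc
      (hd.continuousOn.locallyIntegrableOn measurableSet_Ioi) hO (isBigO_bose_mul_mtPolylog hj k) hs
  exact IntegrableOn.congr_fun h (itoIntegrand_eq hj k s) measurableSet_Ioi

theorem itoXi_eq {j : ℕ} (hj : 1 ≤ j) (k : ℕ) (s : ℂ) :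
    itoXi (fun _ : Fin j => 2) k s =
      1 / Complex.Gamma s * mellin (fun t => bose t * mtPolylog j k t) s := by
  rw [itoXi, mellin, setIntegral_congr_fun measurableSet_Ioi (itoIntegrand_eq hj k s)]

theorem differentiableOn_itoXi {j : ℕ} (hj : 1 ≤ j) (k : ℕ) :
    DifferentiableOn ℂ (itoXi (fun _ : Fin j => 2) k) {s | 1 - (j : ℝ) < s.re} := by
  have hd := (tame_mtPolylog j k).expDecay_bose_mul
  obtain ⟨c, hc, hO⟩ := hd.decay
  intro s hs
  have h := mellin_differentiableAt_of_isBigO_rpow_exp hc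
    (hd.continuousOn.locallyIntegrableOn measurableSet_Ioi) hO
    (isBigO_bose_mul_mtPolylog hj k) hs
  have hΓ : DifferentiableAt ℂ (fun s => 1 / Complex.Gamma s) s := by
    simpa only [one_div] using Complex.differentiable_one_div_Gamma s
  rw [funext (itoXi_eq hj k)]
  exact (hΓ.mul h).differentiableWithinAt

/-! ### Meromorphic continuation of the series -/

theorem Tame.differentiableOn_gamma_mellin {h : ℝ → ℂ} (hh : Tame h) (c : ℕ) :
    DifferentiableOn ℂ (fun s => 1 / Complex.Gamma (s + c) *
      mellin (fun t => bose t * h t) (s + c)) {s | 1 < s.re} := by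
  have h1 : DifferentiableOn ℂ (fun s => 1 / Complex.Gamma s * mellin (fun t => bose t * h t) s)
      {s | 1 < s.re} := by
    refine DifferentiableOn.mul ?_ hh.differentiableOn_mellin_bose_mul
    simpa only [one_div] using Complex.differentiable_one_div_Gamma.differentiableOn
  refine h1.comp (f := fun s : ℂ => s + c) (by fun_prop) fun s hs => ?_
  have hs : 1 < s.re := hs
  have : (0 : ℝ) ≤ c := Nat.cast_nonneg c
  simp only [mem_ofPred_eq, Complex.add_re, Complex.natCast_re]
  linarith

/-- The factor 1/Γ is entire, so only the Mellin transform needs continuing. The shift c is b_{k+1}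
for the Miyagawa series and 0 otherwise. -/
theorem Tame.exists_isMeromorphicContinuation {h : ℝ → ℂ} (hh : Tame h) (c : ℕ) {f : ℂ → ℂ}
    {σ : ℝ} (hf : DifferentiableOn ℂ f {s | σ < s.re})
    (hfe : ∀ s : ℂ, 1 < s.re → f s =
      1 / Complex.Gamma (s + c) * mellin (fun t => bose t * h t) (s + c)) :
    ∃ F : ℂ → ℂ, IsMeromorphicContinuation σ f F := by
  obtain ⟨F, hF, hFe⟩ := hh.exists_meromorphicOn_bose_mul
  set G : ℂ → ℂ := fun s => (Complex.Gamma s)⁻¹ * F s with hG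
  have hGm : MeromorphicOn G univ := fun s hs =>
    (Complex.differentiable_one_div_Gamma.analyticAt s).meromorphicAt.mul (hF s hs)
  have hmap : ∀ s : ℂ, Tendsto (fun z : ℂ => z + c) (𝓝[≠] s) (𝓝[≠] (s + c)) := fun s =>
    tendsto_nhdsWithin_of_tendsto_nhds_of_eventually_within _
      ((by fun_prop : Continuous fun z : ℂ => z + c).tendsto s |>.mono_left nhdsWithin_le_nhds)
      (by filter_upwards [self_mem_nhdsWithin] with z hz using fun h => hz (add_left_injective _ h))
  refine ⟨_, isMeromorphicContinuation_toMeromorphicNFOn (G := fun s => G (s + c)) (τ := 1) hf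
    (fun s _ => (hGm (s + c) (mem_univ _)).comp_analyticAt (g := fun z : ℂ => z + c)
      (by fun_prop)) fun s hs => ?_⟩
  have hs' : 1 < (s + c).re := by
    have : (0 : ℝ) ≤ c := Nat.cast_nonneg c
    rw [Complex.add_re, Complex.natCast_re]
    linarith
  have h1 := (hmap s).eventually (hFe (s + c) hs')
  have h2 := eventually_nhdsWithin_of_eventually_nhds (s := {s}ᶜ) ((isOpen_re_gt 1).mem_nhds hs)
  filter_upwards [h1, h2] with z hz hz1
  rw [hfe z hz1, ← hz, hG, one_div]

theorem exists_continuation_ezZeta (n : ℕ) :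
    ∃ F : ℂ → ℂ, IsMeromorphicContinuation 1 (fun s => ezZeta (onesThen n s)) F := by
  have he : ∀ s : ℂ, 1 < s.re → ezZeta (onesThen n s) = 1 / Complex.Gamma (s + (0 : ℕ)) *
      mellin (fun t => bose t * boseInt^[n] (fun _ => 1) t) (s + (0 : ℕ)) := fun s hs => by
    simpa [ezZeta] using (hasSum_ezTerm n hs).tsum_eq
  exact (tame_iterate_boseInt_one n).exists_isMeromorphicContinuation 0
    (((tame_iterate_boseInt_one n).differentiableOn_gamma_mellin 0).congr he) he

theorem exists_continuation_itoXi {j : ℕ} (hj : 1 ≤ j) (k : ℕ) :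
    ∃ F : ℂ → ℂ, IsMeromorphicContinuation (1 - (j : ℝ)) (itoXi (fun _ : Fin j => 2) k) F :=
  (tame_mtPolylog j k).exists_isMeromorphicContinuation 0 (differentiableOn_itoXi hj k)
    fun s _ => by simpa using itoXi_eq hj k s

theorem exists_continuation_miyagawaZeta {l a k : ℕ} (ha : a ≤ l) (b : Fin (k + 1) → ℕ) :
    ∃ F : ℂ → ℂ, IsMeromorphicContinuation 1
      (fun s => miyagawaZeta (zeroTwosOnes l a) (shiftedIndex b s)) F := by
  have hh := (tame_polylogMul a (l - a)).chainInt b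
  have he : ∀ s : ℂ, 1 < s.re → miyagawaZeta (zeroTwosOnes l a) (shiftedIndex b s) = _ :=
    fun s hs => (hasSum_miyagawaTerm ha b hs).tsum_eq
  exact hh.exists_isMeromorphicContinuation (b (Fin.last k))
    ((hh.differentiableOn_gamma_mellin (b (Fin.last k))).congr he) he

/-! ### The identity in the half-plane of convergence -/

theorem mellin_bose_mul_sum {ι : Type*} (S : Finset ι) (c : ι → ℂ) {f : ι → ℝ → ℂ} {g : ℝ → ℂ}
    (hf : ∀ i ∈ S, Tame (f i)) (hg : EqOn g (fun t => ∑ i ∈ S, c i * f i t) (Ioi 0)) {s : ℂ}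
    (hs : 1 < s.re) :
    mellin (fun t => bose t * g t) s = ∑ i ∈ S, c i * mellin (fun t => bose t * f i t) s := by
  have h1 : EqOn (fun t => bose t * g t) (fun t => ∑ i ∈ S, c i * (bose t * f i t)) (Ioi 0) := by
    intro t ht
    simp only
    rw [hg ht, Finset.mul_sum]
    exact Finset.sum_congr rfl fun i _ => by ring
  rw [mellin_congr h1, mellin_sum S (f := fun i t => c i * (bose t * f i t)) fun i hi =>
    ((hf i hi).mellinConvergent_bose_mul hs).const_smul (c i)]
  exact Finset.sum_congr rfl fun i _ => mellin_const_mul _ _ _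

/-- Iterate T Li_{{2}^j;i} = ζ_MT({2}^j; i+1) - Li_{{2}^j;i+1}; each constant produced is then hit
by the remaining powers of T. -/
theorem iterate_boseInt_mtPolylog (j k : ℕ) :
    EqOn (boseInt^[k] (mtPolylog j 0))
      (fun t => ∑ i ∈ Finset.Icc 1 k, ((-1) ^ (i - 1) * mtZeta (fun _ : Fin j => (2 : ℂ)) (i : ℂ)) *
        boseInt^[k - i] (fun _ => 1) t + (-1) ^ k * mtPolylog j k t) (Ioi 0) := by
  induction k with
  | zero => intro t _; simp
  | succ k ih =>
    intro t ht
    -- Index 0, unused by the sum, encodes the polylogarithm term, so that linearity applies to a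
    -- single finite sum.
    set c : ℕ → ℂ := fun i =>
      if i = 0 then (-1) ^ k else (-1) ^ (i - 1) * mtZeta (fun _ : Fin j => (2 : ℂ)) (i : ℂ) with hc
    set f : ℕ → ℝ → ℂ := fun i =>
      if i = 0 then mtPolylog j k else boseInt^[k - i] fun _ => 1 with hf
    have hf' : ∀ i ∈ Finset.range (k + 1), Tame (f i) := by
      intro i _
      simp only [hf]
      split_ifs
      · exact tame_mtPolylog j k
      · exact tame_iterate_boseInt_one _
    have hsplit : ∀ g : ℕ → ℂ, ∑ i ∈ Finset.range (k + 1), g i =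
        ∑ i ∈ Finset.Icc 1 k, g i + g 0 := by
      intro g
      rw [Finset.range_eq_Ico, Finset.sum_eq_sum_Ico_succ_bot (Nat.succ_pos k), add_comm]
      rfl
    have hih : EqOn (boseInt^[k] (mtPolylog j 0))
        (fun t => ∑ i ∈ Finset.range (k + 1), c i * f i t) (Ioi 0) := by
      refine ih.trans fun t _ => ?_
      simp only
      rw [hsplit]
      congr 1
      · refine Finset.sum_congr rfl fun i hi => ?_
        have : i ≠ 0 := by have := (Finset.mem_Icc.1 hi).1; omega
        simp [hc, hf, this]
    rw [Function.iterate_succ_apply', boseInt_congr hih ht, boseInt_sum _ _ hf' ht]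
    simp only
    rw [hsplit, Finset.sum_Icc_succ_top (by omega), add_assoc]
    congr 1
    · refine Finset.sum_congr rfl fun i hi => ?_
      have h1 := Finset.mem_Icc.1 hi
      have h0 : i ≠ 0 := by omega
      have h2 : k + 1 - i = (k - i) + 1 := by omega
      simp [hc, hf, h0, h2, Function.iterate_succ_apply']
    · rw [mtZeta_eq]
      simp only [hc, hf, if_true, mtPolylog, Nat.add_sub_cancel, Nat.sub_self,
        Function.iterate_zero, id_eq, pow_succ]
      ring

theorem boseInt_ofReal_eq_sub : (boseInt fun t => (t : ℂ)) = fun t => riemannZeta 2 - dilogCompl t :=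
  funext fun t => by simp [dilogCompl]

/-- One integration by parts. Together with `boseInt_ofReal_eq_sub` this is Euler's reflection
formula for the dilogarithm, the source of the whole identity. -/
theorem boseInt_ofReal_eq_add :
    EqOn (boseInt fun t => (t : ℂ)) (fun t => tailInt^[2] bose t + t * tailInt bose t) (Ioi 0) := by
  have hd : ExpDecay bose := by simpa using (Tame.const 1).expDecay_bose_mul
  intro t ht
  have h := hd.tailInt_pow_succ_mul 0 ht
  simp only [zero_add, pow_one, pow_zero, one_mul, Nat.cast_zero] at h
  have h2 : boseInt (fun t => (t : ℂ)) t = tailInt (fun u => (u : ℂ) * bose u) t := by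
    simp only [boseInt, mul_comm]
  rw [h2, h, add_comm]
  rfl

theorem boseInt_ofReal_pow_eq_dilogCompl (l : ℕ) :
    (fun t => boseInt (fun t => (t : ℂ)) t ^ l) = fun t => ∑ j ∈ Finset.range (l + 1),
      ((l.choose j : ℂ) * riemannZeta 2 ^ (l - j) * (-1) ^ j) * mtPolylog j 0 t := by
  funext t
  rw [boseInt_ofReal_eq_sub]
  simp only [mtPolylog]
  rw [sub_eq_neg_add, add_pow]
  refine Finset.sum_congr rfl fun j _ => ?_
  rw [neg_pow]
  ring

theorem boseInt_ofReal_pow_eq_polylogMul (l : ℕ) :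
    EqOn (fun t => boseInt (fun t => (t : ℂ)) t ^ l) (fun t => ∑ a ∈ Finset.range (l + 1),
      (l.choose a : ℂ) * ((t : ℂ) ^ (l - a) * polylogMul a (l - a) t)) (Ioi 0) := by
  intro t ht
  simp only
  rw [boseInt_ofReal_eq_add ht, add_pow]
  refine Finset.sum_congr rfl fun a _ => ?_
  rw [mul_pow, polylogMul]
  ring

theorem one_div_Gamma_eq_risingChoose {s : ℂ} (hs : 0 < s.re) (n : ℕ) :
    1 / Complex.Gamma s = (n ! : ℂ) * risingChoose s n * (1 / Complex.Gamma (s + n)) := by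
  have key : Complex.Gamma (s + n) = (∏ i ∈ Finset.range n, (s + i)) * Complex.Gamma s := by
    induction n with
    | zero => simp
    | succ n ih =>
      have hne : s + n ≠ 0 := fun h0 => by
        have := congrArg Complex.re h0
        simp at this
        have hi : (0 : ℝ) ≤ n := Nat.cast_nonneg n
        linarith
      rw [Finset.prod_range_succ, Nat.cast_add, Nat.cast_one, ← add_assoc,
        Complex.Gamma_add_one _ hne, ih]
      ring
  have h1 : Complex.Gamma s ≠ 0 := Complex.Gamma_ne_zero_of_re_pos hs
  have h2 : Complex.Gamma (s + n) ≠ 0 := by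
    refine Complex.Gamma_ne_zero_of_re_pos ?_
    rw [Complex.add_re, Complex.natCast_re]
    positivity
  have hn : (n ! : ℂ) ≠ 0 := Nat.cast_ne_zero.2 (Nat.factorial_ne_zero n)
  rw [risingChoose, mul_div_cancel₀ _ hn, mul_one_div, eq_div_iff h2, one_div, key]
  field_simp

theorem mellin_boseInt_pow_eq_itoXi (l k : ℕ) {s : ℂ} (hs : 1 < s.re) :
    1 / Complex.Gamma s *
        mellin (fun t => bose t * boseInt^[k] (fun t => boseInt (fun t => (t : ℂ)) t ^ l) t) s =
      riemannZeta 2 ^ l * ezZeta (onesThen k s) +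
        ∑ j ∈ Finset.Icc 1 l, (l.choose j : ℂ) * riemannZeta 2 ^ (l - j) * (-1) ^ j *
          (∑ i ∈ Finset.Icc 1 k,
              (-1) ^ (i - 1) * mtZeta (fun _ : Fin j => (2 : ℂ)) (i : ℂ) *
                ezZeta (onesThen (k - i) s) +
            (-1) ^ k * itoXi (fun _ : Fin j => 2) k s) := by
  have hez : ∀ n, ezZeta (onesThen n s) = 1 / Complex.Gamma s *
      mellin (fun t => bose t * boseInt^[n] (fun _ => 1) t) s := fun n =>
    (hasSum_ezTerm n hs).tsum_eq
  rw [boseInt_ofReal_pow_eq_dilogCompl, mellin_bose_mul_sum _ _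
    (fun j _ => (tame_mtPolylog j 0).iterate_boseInt k)
    (iterate_boseInt_sum _ _ (fun j _ => tame_mtPolylog j 0) k) hs, Finset.mul_sum,
    Finset.range_eq_Ico, Finset.sum_eq_sum_Ico_succ_bot (Nat.succ_pos l)]
  congr 1
  -- The term j = 0 is the separate summand ζ(2)^l ζ({1}^k, s).
  · have : mtPolylog 0 0 = fun _ => 1 := by funext t; simp [mtPolylog]
    rw [hez, this]
    simp
    ring
  · refine Finset.sum_congr rfl fun j hj => ?_
    have hj1 : 1 ≤ j := (Finset.mem_Ico.1 hj).1
    have hsum : mellin (fun t => bose t * boseInt^[k] (mtPolylog j 0) t) s =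
        ∑ i ∈ Finset.Icc 1 k, ((-1) ^ (i - 1) * mtZeta (fun _ : Fin j => (2 : ℂ)) (i : ℂ)) *
          mellin (fun t => bose t * boseInt^[k - i] (fun _ => 1) t) s +
        (-1) ^ k * mellin (fun t => bose t * mtPolylog j k t) s := by
      have hT : Tame fun t => ∑ i ∈ Finset.Icc 1 k,
          ((-1) ^ (i - 1) * mtZeta (fun _ : Fin j => (2 : ℂ)) (i : ℂ)) *
            boseInt^[k - i] (fun _ => 1) t :=
        Tame.sum _ fun i _ => (Tame.const _).mul (tame_iterate_boseInt_one _)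
      have h1 := hT.mellinConvergent_bose_mul hs
      have h2 := ((Tame.const ((-1) ^ k)).mul (tame_mtPolylog j k)).mellinConvergent_bose_mul hs
      have h3 := (hasMellin_add h1 h2).2
      rw [mellin_bose_mul_sum _ _ (fun i _ => tame_iterate_boseInt_one _) (fun _ _ => rfl) hs] at h3
      have h4 : mellin (fun t => bose t * ((-1) ^ k * mtPolylog j k t)) s =
          (-1) ^ k * mellin (fun t => bose t * mtPolylog j k t) s := by
        rw [← mellin_const_mul]
        congr 1
        funext t
        ring
      rw [← h4, ← h3]
      refine mellin_congr (fun t ht => ?_) s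
      rw [iterate_boseInt_mtPolylog j k ht]
      ring
    rw [hsum, itoXi_eq hj1]
    simp only [hez]
    rw [mul_left_comm, mul_add (1 / Complex.Gamma s), Finset.mul_sum]
    congr 2
    · exact Finset.sum_congr rfl fun i _ => by ring
    · ring

theorem mellin_boseInt_pow_eq_miyagawaZeta (l k : ℕ) {s : ℂ} (hs : 1 < s.re) :
    1 / Complex.Gamma s *
        mellin (fun t => bose t * boseInt^[k] (fun t => boseInt (fun t => (t : ℂ)) t ^ l) t) s =
      ∑ a ∈ Finset.range (l + 1), ∑ b ∈ Finset.Nat.antidiagonalTuple (k + 1) (l - a),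
        ((l ! : ℂ) / (a ! : ℂ)) * risingChoose s (b (Fin.last k)) *
          miyagawaZeta (zeroTwosOnes l a) (shiftedIndex b s) := by
  have hT : ∀ a ∈ Finset.range (l + 1),
      Tame fun t => (t : ℂ) ^ (l - a) * polylogMul a (l - a) t := fun a _ =>
    (Tame.ofReal_pow _).mul (tame_polylogMul a (l - a))
  rw [mellin_bose_mul_sum _ _ (fun a ha => (hT a ha).iterate_boseInt k)
    ((iterate_boseInt_congr (boseInt_ofReal_pow_eq_polylogMul l) k).trans
      (iterate_boseInt_sum _ _ hT k)) hs, Finset.mul_sum]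
  refine Finset.sum_congr rfl fun a ha => ?_
  have hal : a ≤ l := Nat.lt_succ_iff.1 (Finset.mem_range.1 ha)
  have hch := fun b : Fin (k + 1) → ℕ => (tame_polylogMul a (l - a)).chainInt b
  rw [mellin_bose_mul_sum _ _ (fun b _ => (Tame.ofReal_pow (b (Fin.last k))).mul (hch b))
    (iterate_boseInt_pow_mul (tame_polylogMul a (l - a)) k (l - a)) hs, Finset.mul_sum,
    Finset.mul_sum]
  refine Finset.sum_congr rfl fun b _ => ?_
  have hm : miyagawaZeta (zeroTwosOnes l a) (shiftedIndex b s) = _ :=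
    (hasSum_miyagawaTerm hal b hs).tsum_eq
  -- The power of t left outside becomes a shift of the Mellin variable.
  have hshift : mellin (fun t => bose t *
        ((t : ℂ) ^ b (Fin.last k) * chainInt k b (polylogMul a (l - a)) t)) s =
      mellin (fun t => bose t * chainInt k b (polylogMul a (l - a)) t)
        (s + b (Fin.last k)) := by
    rw [← mellin_cpow_smul]
    refine mellin_congr (fun t _ => ?_) s
    simp only [Complex.cpow_natCast, smul_eq_mul]
    ring
  have hfac : ∀ n : ℕ, (n ! : ℂ) ≠ 0 := fun n => Nat.cast_ne_zero.2 (Nat.factorial_ne_zero n)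
  have hchoose : (l.choose a : ℂ) = (l ! : ℂ) / ((a ! : ℂ) * ((l - a)! : ℂ)) := by
    rw [Nat.cast_choose ℂ hal]
  -- With b the last entry, binom(l, a) · (l-a)!/b! · b! collapses to l!/a!; the b! comes from Γ(s +
  -- b)/Γ(s).
  rw [hshift, hm, one_div_Gamma_eq_risingChoose (by linarith) (b (Fin.last k)), hchoose]
  have h1 := hfac a
  have h2 := hfac (l - a)
  have h3 := hfac (b (Fin.last k))
  field_simp

/-! ### The identity of meromorphic functions -/

theorem AnalyticAt.eq_of_eqOn_re_gt {F G : ℂ → ℂ} {σ : ℝ} {s : ℂ} (hF : MeromorphicOn F univ)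
    (hG : MeromorphicOn G univ) (hFG : EqOn F G {s | σ < s.re}) (hFs : AnalyticAt ℂ F s)
    (hGs : AnalyticAt ℂ G s) : F s = G s := by
  have h : F =ᶠ[𝓝[≠] s] G :=
    eventuallyEq_nhdsNE_of_re_gt (ρ := s.re - 1) (hF.mono_set (subset_univ _))
      (hG.mono_set (subset_univ _)) (fun _ => eventuallyEq_nhdsNE_of_eqOn hFG) (by linarith)
  exact ((hFs.meromorphicNFAt.eventuallyEq_nhdsNE_iff_eventuallyEq_nhds
    hGs.meromorphicNFAt).1 h).eq_of_nhds

theorem differentiable_risingChoose (n : ℕ) : Differentiable ℂ fun s => risingChoose s n := by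
  unfold risingChoose
  fun_prop

end

theorem mainTheorem1 (l k : ℕ) (hl : 1 ≤ l) (hk : 1 ≤ k) :
    -- all defining series and integrals converge absolutely
    (∀ n ≤ k, ∀ s : ℂ, 1 < s.re → Summable (ezTerm (onesThen n s))) ∧
    (∀ j ∈ Finset.Icc 1 l, ∀ i ∈ Finset.Icc 1 k,
      Summable (mtTerm (fun _ : Fin j => (2 : ℂ)) (i : ℂ))) ∧
    (∀ j ∈ Finset.Icc 1 l, ∀ s : ℂ, 1 - (j : ℝ) < s.re →
      IntegrableOn (itoIntegrand (fun _ : Fin j => 2) k s) (Set.Ioi 0)) ∧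
    (∀ a ≤ l, ∀ b ∈ Finset.Nat.antidiagonalTuple (k + 1) (l - a), ∀ s : ℂ, 1 < s.re →
      Summable (miyagawaTerm (zeroTwosOnes l a) (shiftedIndex b s))) ∧
    -- the meromorphic continuations `Z n` of `ζ({1}^n, s)`, `X j` of `ξ_MT(({2}^j; k); s)` and
    -- `M a b` of `ζ_MT(0, {2}^a, {1}^{l-a}; b₁ + 1, …, b_k + 1, b_{k+1} + s)` exist ...
    ∃ (Z : ℕ → ℂ → ℂ) (X : ℕ → ℂ → ℂ) (M : ℕ → (Fin (k + 1) → ℕ) → ℂ → ℂ),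
      (∀ n ≤ k, IsMeromorphicContinuation 1 (fun s => ezZeta (onesThen n s)) (Z n)) ∧
      (∀ j ∈ Finset.Icc 1 l,
        IsMeromorphicContinuation (1 - (j : ℝ)) (itoXi (fun _ : Fin j => 2) k) (X j)) ∧
      (∀ a ≤ l, ∀ b ∈ Finset.Nat.antidiagonalTuple (k + 1) (l - a),
        IsMeromorphicContinuation 1
          (fun s => miyagawaZeta (zeroTwosOnes l a) (shiftedIndex b s)) (M a b)) ∧
      -- ... and satisfy the identity at every `s` that is not a pole of one of them
      ∀ s : ℂ,
        (∀ n ≤ k, AnalyticAt ℂ (Z n) s) →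
        (∀ j ∈ Finset.Icc 1 l, AnalyticAt ℂ (X j) s) →
        (∀ a ≤ l, ∀ b ∈ Finset.Nat.antidiagonalTuple (k + 1) (l - a),
          AnalyticAt ℂ (M a b) s) →
        riemannZeta 2 ^ l * Z k s +
          ∑ j ∈ Finset.Icc 1 l, (l.choose j : ℂ) * riemannZeta 2 ^ (l - j) * (-1) ^ j *
            (∑ i ∈ Finset.Icc 1 k,
                (-1) ^ (i - 1) * mtZeta (fun _ : Fin j => (2 : ℂ)) (i : ℂ) * Z (k - i) s +
              (-1) ^ k * X j s) =
        ∑ a ∈ Finset.range (l + 1), ∑ b ∈ Finset.Nat.antidiagonalTuple (k + 1) (l - a),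
          ((l ! : ℂ) / (a ! : ℂ)) * risingChoose s (b (Fin.last k)) * M a b s := by
  refine ⟨fun n _ s hs => (hasSum_ezTerm n hs).summable, fun j hj i _ => ?_,
    fun j hj s hs => integrableOn_itoIntegrand (Finset.mem_Icc.1 hj).1 k hs,
    fun a ha b _ s hs => (hasSum_miyagawaTerm ha b hs).summable, ?_⟩
  · rw [funext (mtTerm_eq j i)]
    exact Complex.summable_ofReal.2 (summable_mtCoeff (Finset.mem_Icc.1 hj).1 i)
  have hZ := exists_continuation_ezZeta
  -- The condition sits inside the existential so that `choose` returns a family on all indices,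
  -- with 0 as dummy value.
  have hX : ∀ j : ℕ, ∃ F, 1 ≤ j →
      IsMeromorphicContinuation (1 - (j : ℝ)) (itoXi (fun _ : Fin j => 2) k) F := fun j => by
    by_cases hj : 1 ≤ j
    · exact (exists_continuation_itoXi hj k).imp fun _ h _ => h
    · exact ⟨0, fun h => absurd h hj⟩
  have hM : ∀ (a : ℕ) (b : Fin (k + 1) → ℕ), ∃ F, a ≤ l → IsMeromorphicContinuation 1
      (fun s => miyagawaZeta (zeroTwosOnes l a) (shiftedIndex b s)) F := fun a b => by
    by_cases ha : a ≤ l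
    · exact (exists_continuation_miyagawaZeta ha b).imp fun _ h _ => h
    · exact ⟨0, fun h => absurd h ha⟩
  choose Z hZ using hZ
  choose X hX using hX
  choose M hM using hM
  refine ⟨Z, X, M, fun n _ => hZ n, fun j hj => hX j (Finset.mem_Icc.1 hj).1,
    fun a ha b _ => hM a b ha, fun s hZs hXs hMs => ?_⟩
  have hrc : ∀ (n : ℕ) (z : ℂ), AnalyticAt ℂ (fun s => risingChoose s n) z := fun n z =>
    (differentiable_risingChoose n).analyticAt z
  -- On Re s > 1 every continuation equals its series or integral, so the two Mellin evaluations
  -- suffice there.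
  refine AnalyticAt.eq_of_eqOn_re_gt (σ := 1)
    (F := fun s => riemannZeta 2 ^ l * Z k s +
      ∑ j ∈ Finset.Icc 1 l, (l.choose j : ℂ) * riemannZeta 2 ^ (l - j) * (-1) ^ j *
        (∑ i ∈ Finset.Icc 1 k,
            (-1) ^ (i - 1) * mtZeta (fun _ : Fin j => (2 : ℂ)) (i : ℂ) * Z (k - i) s +
          (-1) ^ k * X j s))
    (G := fun s => ∑ a ∈ Finset.range (l + 1),
      ∑ b ∈ Finset.Nat.antidiagonalTuple (k + 1) (l - a),
        ((l ! : ℂ) / (a ! : ℂ)) * risingChoose s (b (Fin.last k)) * M a b s) ?_ ?_ ?_ ?_ ?_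
  · intro z _
    have hZm : ∀ n, MeromorphicAt (Z n) z := fun n => ((hZ n).2.2 (mem_univ z)).meromorphicAt
    refine ((MeromorphicAt.const _ z).mul (hZm k)).add (MeromorphicAt.fun_sum fun j hj => ?_)
    have hXm : MeromorphicAt (X j) z :=
      ((hX j (Finset.mem_Icc.1 hj).1).2.2 (mem_univ z)).meromorphicAt
    exact (MeromorphicAt.const _ z).mul ((MeromorphicAt.fun_sum fun i _ =>
      (MeromorphicAt.const _ z).mul (hZm _)).add ((MeromorphicAt.const _ z).mul hXm))
  · intro z _
    refine MeromorphicAt.fun_sum fun a ha => MeromorphicAt.fun_sum fun b _ => ?_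
    have hMm : MeromorphicAt (M a b) z :=
      ((hM a b (Nat.lt_succ_iff.1 (Finset.mem_range.1 ha))).2.2 (mem_univ z)).meromorphicAt
    exact ((MeromorphicAt.const _ z).mul (hrc _ z).meromorphicAt).mul hMm
  · intro z hz
    have hz : 1 < z.re := hz
    have hZz : ∀ n, Z n z = ezZeta (onesThen n z) := fun n => (hZ n).2.1 hz
    have hXz : ∀ j ∈ Finset.Icc 1 l, X j z = itoXi (fun _ : Fin j => 2) k z := fun j hj => by
      have hj1 := (Finset.mem_Icc.1 hj).1
      refine (hX j hj1).2.1 (mem_ofPred_eq ▸ ?_)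
      have : (1 : ℝ) ≤ j := by exact_mod_cast hj1
      show 1 - (j : ℝ) < z.re
      linarith
    have h1 := (mellin_boseInt_pow_eq_itoXi l k hz).symm.trans
      (mellin_boseInt_pow_eq_miyagawaZeta l k hz)
    simp only [hZz]
    rw [Finset.sum_congr rfl fun j hj => by rw [hXz j hj], h1]
    refine Finset.sum_congr rfl fun a ha => Finset.sum_congr rfl fun b _ => ?_
    rw [(hM a b (Nat.lt_succ_iff.1 (Finset.mem_range.1 ha))).2.1 hz]
  · refine (analyticAt_const.mul (hZs k le_rfl)).add
      (Finset.analyticAt_fun_sum _ fun j hj => analyticAt_const.mul ?_)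
    exact (Finset.analyticAt_fun_sum _ fun i _ =>
      analyticAt_const.mul (hZs _ (Nat.sub_le k i))).add (analyticAt_const.mul (hXs j hj))
  · exact Finset.analyticAt_fun_sum _ fun a ha => Finset.analyticAt_fun_sum _ fun b hb =>
      (analyticAt_const.mul (hrc _ s)).mul (hMs a (Nat.lt_succ_iff.1 (Finset.mem_range.1 ha)) b hb)
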